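/- **Theorem 1.13.** Let $V_L(t)\in\mathbb Z[t^{1/2},t^{-1/2}]$ be the Jones polynomial of an oriented link $L$, normalized by $V_{\text{unknot}}=1$ and $t^{-1}V_{L_+}-tV_{L_-}=(t^{1/2}-t^{-1/2})V_{L_0}$, where $L_+$ has a positive (right-handed) crossing, and let $c(L)$ be the number of components of $L$. Let $L$ be an oriented link diagram that meets some disk in two vertical arcs, one directed upwards and the other downwards. Let $k$ be an odd positive integer, and let $\bar t_k(L)$ be the (unoriented) diagram obtained from $L$ by replacing these two arcs by a vertical twist with $k$ crossings ($k$ half twists), with the handedness for which all $k$ crossings are positive when both strands of the twist are directed upwards. Let $t^{1/2}\in\mathbb C^*$ be such that $t^k=(-1)^k$ and $t\neq -1$; equivalently $t^{1/2}=-ie^{\pi i m/k}$ for some integer $m$, with $t\ne -1$, and fix such an $m$. Either $c(\bar t_k(L))<c(L)$, which holds exactly when the two arcs lie on different components of $L$, or $c(\bar t_k(L))=c(L)$, which holds exactly when they lie on one component of $L$. (i) Suppose $c(\bar t_k(L))<c(L)$. Let $L_i$ be either one of the two components of $L$ through the disk and $\lambda=\mathrm{lk}(L_i,L-L_i)$.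 Then $\bar t_k(L)$ has exactly one orientation that, outside the disk, is opposite to that of $L$ on $L_i$ and agrees with that of $L$ on all other components, and with this orientation $$V_{\bar t_k(L)}(t)=(-1)^m i^k t^{-3\lambda}V_L(t)=(-1)^{m+\lambda}i^k e^{-6\pi i m\lambda/k}V_L(t).$$ (ii) Suppose $c(\bar t_k(L))=c(L)$. Let $L_\infty$ be the smoothing obtained from $L$ by replacing the two arcs in the disk by an arc joining the two upper endpoints and an arc joining the two lower endpoints, with the orientation (which exists and is unique) that agrees with that of $L$ outside the disk. Then $c(L_\infty)>c(L)$, and the two new arcs lie on different components of $L_\infty$. Let $L_i$ be either one of these two components and $\lambda=\mathrm{lk}(L_i,L_\infty-L_i)$. Then $\bar t_k(L)$ has exactly one orientation that, outside the disk, is opposite to that of $L_\infty$ on $L_i$ and agrees with that of $L_\infty$ on all other components, and with this orientation $$V_{\bar t_k(L)}(t)=t^{-3\lambda}V_L(t)=(-1)^{\lambda}e^{-6\pi i m\lambda/k}V_L(t).$$ -/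

import Mathlib

namespace LinkTheory

/-- The ends of edges (`darts`) of a diagram with crossings `X`, marked points `P` and `n` boundary
points. Every dart is attached to a crossing, a marked point or a boundary point.
The four slots at a crossing are numbered `0, 1, 2, 3` counterclockwise; the *under* strand runs
through the slots `0, 2` and the *over* strand through the slots `1, 3`. -/
inductive Dart (X P : Type*) (n : ℕ)
  | cr (x : X) (s : Fin 4) : Dart X P n
  | pt (p : P) (s : Fin 2) : Dart X P n
  | bd (i : Fin n) : Dart X P n

/-- A tangle diagram with crossings `X`, marked (two-valent, inessential) points `P`, edges `E` and
`n` boundary points, given as a planar-diagram code: every dart is labelled by the edge it belongs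
to, and every edge has exactly two ends. A circle without crossings is an edge both of whose ends
are at the same marked point. For `n = 0` this is a link diagram. -/
structure Tangle (X P E : Type*) (n : ℕ) where
  label : Dart X P n → E
  two_ends : ∀ e : E, ∃ d d' : Dart X P n, d ≠ d' ∧ ∀ c, label c = e ↔ c = d ∨ c = d'

/-- A (not yet oriented) link diagram. -/
abbrev Diagram (X P E : Type*) := Tangle X P E 0

namespace Tangle

variable {X P E X' P' E' X'' P'' E'' : Type*} {n : ℕ}

/-! ### Planarity -/

/-- Rotation of a dart counterclockwise around its vertex. All boundary points together count as
one `n`-valent vertex (the disk bounded by the boundary circle, collapsed to a point). -/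
def rot : Dart X P n → Dart X P n
  | .cr x s => .cr x (s + 1)
  | .pt p s => .pt p (s + 1)
  | .bd i => .bd (finRotate n i)

/-- A dart `d` also stands for the corner between `d` and `rot d`. Two corners are adjacent if they
lie on the same side of the same edge; the classes are the faces. -/
def FaceRel (D : Tangle X P E n) (d c : Dart X P n) : Prop :=
  D.label d = D.label (rot c) ∧ d ≠ rot c

/-- Darts at the same vertex or on the same edge; the classes are the connected components of the
underlying graph. -/
def ConnRel (D : Tangle X P E n) (d c : Dart X P n) : Prop :=
  c = rot d ∨ D.label d = D.label c

/-- Every connected component of the underlying graph (boundary collapsed to one vertex), with the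
cyclic orders at its vertices, lies on a sphere: Euler's formula `V - E + F = 2 C`. -/
def Planar (D : Tangle X P E n) : Prop :=
  Nat.card X + Nat.card P + min n 1 + Nat.card (Quot D.FaceRel) =
    Nat.card E + 2 * Nat.card (Quot D.ConnRel)

/-! ### Link components and orientations -/

/-- Two edges that follow each other on a strand. -/
inductive StrandRel (D : Tangle X P E n) : E → E → Prop
  | underStrand (x : X) : StrandRel D (D.label (.cr x 0)) (D.label (.cr x 2))
  | overStrand (x : X) : StrandRel D (D.label (.cr x 1)) (D.label (.cr x 3))
  | point (p : P) : StrandRel D (D.label (.pt p 0)) (D.label (.pt p 1))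

/-- The link components. -/
def Component (D : Tangle X P E n) : Type _ := Quot D.StrandRel

/-- The component containing an edge. -/
def component (D : Tangle X P E n) (e : E) : D.Component := Quot.mk _ e

/-- The number `c(D)` of components. -/
noncomputable def numComponents (D : Tangle X P E n) : ℕ := Nat.card D.Component

/-- An orientation: `out d` says that the strand leaves its vertex along the dart `d`. A strand that
leaves one end of an edge arrives at the other end, and strands run straight through vertices. -/
@[ext] structure Orientation (D : Tangle X P E n) where
  out : Dart X P n → Bool
  edge : ∀ d d', d ≠ d' → D.label d = D.label d' → out d' = !out d
  underStrand : ∀ x, out (.cr x 2) = !out (.cr x 0)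
  overStrand : ∀ x, out (.cr x 3) = !out (.cr x 1)
  point : ∀ p, out (.pt p 1) = !out (.pt p 0)

/-- The sign of a crossing: `+1` if the direction of the under strand is obtained from the direction
of the over strand by a counterclockwise quarter turn (a right-handed crossing), else `-1`. -/
def Orientation.sign {D : Tangle X P E n} (o : D.Orientation) (x : X) : ℤ :=
  if o.out (.cr x 1) = o.out (.cr x 2) then 1 else -1

open Classical in
/-- The linking number `lk(A, B)` of two disjoint sets of components of an oriented diagram: half the
sum of the signs of the crossings between `A` and `B`. (In a planar diagram the sum is even, so
that the division is exact.) -/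
noncomputable def lk [Fintype X] (D : Tangle X P E n) (o : D.Orientation)
    (A B : Set D.Component) : ℤ :=
  (∑ x : X,
    if (D.component (D.label (.cr x 0)) ∈ A ∧ D.component (D.label (.cr x 1)) ∈ B) ∨
        (D.component (D.label (.cr x 0)) ∈ B ∧ D.component (D.label (.cr x 1)) ∈ A)
    then o.sign x else 0) / 2

/-! ### The Jones polynomial -/

/-- The curves of a Kauffman state: `S` is the set of crossings that get a `B`-smoothing, the others
get an `A`-smoothing, which joins the two regions swept out when the over strand is turned
counterclockwise up to the under strand. -/
inductive StateRel (D : Tangle X P E n) (S : Finset X) : E → E → Prop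
  | a₁ (x : X) (h : x ∉ S) : StateRel D S (D.label (.cr x 0)) (D.label (.cr x 1))
  | a₂ (x : X) (h : x ∉ S) : StateRel D S (D.label (.cr x 2)) (D.label (.cr x 3))
  | b₁ (x : X) (h : x ∈ S) : StateRel D S (D.label (.cr x 1)) (D.label (.cr x 2))
  | b₂ (x : X) (h : x ∈ S) : StateRel D S (D.label (.cr x 3)) (D.label (.cr x 0))
  | point (p : P) : StateRel D S (D.label (.pt p 0)) (D.label (.pt p 1))

/-- The number of closed curves of a Kauffman state. -/
noncomputable def loops (D : Tangle X P E n) (S : Finset X) : ℕ := Nat.card (Quot (D.StateRel S))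

open LaurentPolynomial in
/-- The Jones polynomial of a nonempty oriented link diagram as a Laurent polynomial in the variable
`T 1 = √t`. It is Kauffman's `(-A ^ 3) ^ (-w) ⟨D⟩` with `⟨unknot⟩ = 1`,
`⟨D⟩ = A ⟨D_A⟩ + A⁻¹ ⟨D_B⟩`, `⟨D ⊔ circle⟩ = (-A ^ 2 - A ^ (-2)) ⟨D⟩`, written in `√t = A ^ (-2)`:
with `p` positive and `m` negative crossings the state `S` contributes
`(-1) ^ (p + m) (√t) ^ (p - 2 m + |S|) (-√t - 1 / √t) ^ (loops - 1)`.
This is the normalization `t⁻¹ V₊ - t V₋ = (√t - 1 / √t) V₀`, `V(unknot) = 1`. -/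
noncomputable def jones [Fintype X] (D : Diagram X P E) (o : D.Orientation) : ℤ[T;T⁻¹] :=
  let p := (Finset.univ.filter fun x : X => o.sign x = 1).card
  let m := (Finset.univ.filter fun x : X => o.sign x = -1).card
  (-1) ^ (p + m) * T ((p : ℤ) - 2 * m) *
    ∑ S : Finset X, T (S.card : ℤ) * (-T 1 - T (-1)) ^ (D.loops S - 1)

/-- The value of the Jones polynomial at a nonzero complex value `r` of `√t`. -/
noncomputable def jonesAt [Fintype X] (D : Diagram X P E) (o : D.Orientation) (r : ℂˣ) : ℂ :=
  LaurentPolynomial.eval₂ (Int.castRingHom ℂ) r (D.jones o)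

/-! ### Replacing the part of a diagram inside a disk

A link diagram with a distinguished disk, met in four boundary points, consists of the tangle `T`
outside the disk and a tangle `I` inside. The four boundary points are numbered counterclockwise
around the disk: `0 = SE`, `1 = NE`, `2 = NW`, `3 = SW`. -/

/-- The labels of the diagram with `T` outside and `I` inside the disk. The boundary points become
marked points, with slot `0` outside and slot `1` inside the disk. -/
def glueLabel (T : Tangle X P E 4) (I : Tangle X' P' E' 4) :
    Dart (X ⊕ X') (P ⊕ P' ⊕ Fin 4) 0 → E ⊕ E'
  | .cr (.inl x) s => .inl (T.label (.cr x s))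
  | .cr (.inr x) s => .inr (I.label (.cr x s))
  | .pt (.inl p) s => .inl (T.label (.pt p s))
  | .pt (.inr (.inl p)) s => .inr (I.label (.pt p s))
  | .pt (.inr (.inr i)) 0 => .inl (T.label (.bd i))
  | .pt (.inr (.inr i)) 1 => .inr (I.label (.bd i))

/-- The darts outside the disk; a boundary point gives the dart that points out of the disk. -/
def outer (X' P' : Type*) : Dart X P 4 → Dart (X ⊕ X') (P ⊕ P' ⊕ Fin 4) 0
  | .cr x s => .cr (.inl x) s
  | .pt p s => .pt (.inl p) s
  | .bd i => .pt (.inr (.inr i)) 0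

/-- The darts inside the disk; a boundary point gives the dart that points into the disk. -/
def inner (X P : Type*) : Dart X' P' 4 → Dart (X ⊕ X') (P ⊕ P' ⊕ Fin 4) 0
  | .cr x s => .cr (.inr x) s
  | .pt p s => .pt (.inr (.inl p)) s
  | .bd i => .pt (.inr (.inr i)) 1

theorem outer_injective : Function.Injective (outer X' P' : Dart X P 4 → _) := by
  rintro (_ | _ | _) (_ | _ | _) h <;> simp_all [outer]

theorem inner_injective : Function.Injective (inner X P : Dart X' P' 4 → _) := by
  rintro (_ | _ | _) (_ | _ | _) h <;> simp_all [inner]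

theorem glueLabel_outer (T : Tangle X P E 4) (I : Tangle X' P' E' 4) (d : Dart X P 4) :
    glueLabel T I (outer X' P' d) = .inl (T.label d) := by
  rcases d with _ | _ | _ <;> rfl

theorem glueLabel_inner (T : Tangle X P E 4) (I : Tangle X' P' E' 4) (d : Dart X' P' 4) :
    glueLabel T I (inner X P d) = .inr (I.label d) := by
  rcases d with _ | _ | _ <;> rfl

theorem outer_or_inner (c : Dart (X ⊕ X') (P ⊕ P' ⊕ Fin 4) 0) :
    (∃ d, c = outer X' P' d) ∨ ∃ d, c = inner X P d := by
  rcases c with ⟨x | x, s⟩ | ⟨p | p | i, s⟩ | i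
  · exact .inl ⟨.cr x s, rfl⟩
  · exact .inr ⟨.cr x s, rfl⟩
  · exact .inl ⟨.pt p s, rfl⟩
  · exact .inr ⟨.pt p s, rfl⟩
  · fin_cases s
    · exact .inl ⟨.bd i, rfl⟩
    · exact .inr ⟨.bd i, rfl⟩
  · exact i.elim0

/-- The link diagram with `T` outside and `I` inside the disk. -/
def glue (T : Tangle X P E 4) (I : Tangle X' P' E' 4) :
    Diagram (X ⊕ X') (P ⊕ P' ⊕ Fin 4) (E ⊕ E') where
  label := glueLabel T I
  two_ends := by
    rintro (e | e)
    · obtain ⟨d, d', hne, h⟩ := T.two_ends e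
      refine ⟨outer X' P' d, outer X' P' d', outer_injective.ne hne, fun c => ?_⟩
      obtain ⟨b, rfl⟩ | ⟨b, rfl⟩ := outer_or_inner c
      · rw [glueLabel_outer, Sum.inl.injEq, h, outer_injective.eq_iff, outer_injective.eq_iff]
      · rw [glueLabel_inner]
        refine ⟨fun hc => by simp at hc, ?_⟩
        rintro (hc | hc) <;> have := congrArg (glueLabel T I) hc <;>
          simp [glueLabel_outer, glueLabel_inner] at this
    · obtain ⟨d, d', hne, h⟩ := I.two_ends e
      refine ⟨inner X P d, inner X P d', inner_injective.ne hne, fun c => ?_⟩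
      obtain ⟨b, rfl⟩ | ⟨b, rfl⟩ := outer_or_inner c
      · rw [glueLabel_outer]
        refine ⟨fun hc => by simp at hc, ?_⟩
        rintro (hc | hc) <;> have := congrArg (glueLabel T I) hc <;>
          simp [glueLabel_outer, glueLabel_inner] at this
      · rw [glueLabel_inner, Sum.inr.injEq, h, inner_injective.eq_iff, inner_injective.eq_iff]

/-- The labels of the vertical twist with `k` crossings, stacked from bottom to top. The edges
`(l, false)` and `(l, true)` are the left and the right edge at level `l`, so that crossing `j` has
the edges of level `j` below and those of level `j + 1` above. The over strand of every crossing
runs from SW to NE: if both strands are directed upwards, then all crossings are positive. -/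
def twistLabel (k : ℕ) : Dart (Fin k) Empty 4 → Fin (k + 1) × Bool
  | .cr j s => ![(j.castSucc, true), (j.succ, true), (j.succ, false), (j.castSucc, false)] s
  | .bd i => ![(0, true), (Fin.last k, true), (Fin.last k, false), (0, false)] i

/-- The vertical twist with `k` crossings (`k` half twists); for `k = 0` two vertical arcs. -/
def twist (k : ℕ) : Tangle (Fin k) Empty (Fin (k + 1) × Bool) 4 where
  label := twistLabel k
  two_ends := by
    rintro ⟨l, b⟩
    refine ⟨if h : l = 0 then .bd (if b then 0 else 3) else .cr (l.pred h) (if b then 1 else 2),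
      if h : l = Fin.last k then .bd (if b then 1 else 2)
        else .cr (l.castPred h) (if b then 0 else 3), ?_, ?_⟩
    · cases b <;> split_ifs <;> simp
    · rintro (⟨j, s⟩ | p | i)
      · have h1 : j.castSucc = l ↔ ∃ h : l ≠ Fin.last k, j = l.castPred h := by
          constructor
          · rintro rfl; exact ⟨(Fin.castSucc_lt_last j).ne, by simp⟩
          · rintro ⟨h, rfl⟩; simp
        have h2 : j.succ = l ↔ ∃ h : l ≠ 0, j = l.pred h := by
          constructor
          · rintro rfl; exact ⟨Fin.succ_ne_zero j, by simp⟩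
          · rintro ⟨h, rfl⟩; simp
        have hk : k ≠ 0 := fun h => (h ▸ j : Fin 0).elim0
        cases b <;> fin_cases s <;> simp [twistLabel, h1, h2] <;> split_ifs <;> simp_all
      · exact p.elim
      · cases b <;> fin_cases i <;> simp [twistLabel] <;> split_ifs <;> simp_all [eq_comm]

/-- The smoothing `∞`: an arc (edge `0`) joining the two lower boundary points and an arc (edge `1`)
joining the two upper ones. -/
def smoothing : Tangle Empty Empty (Fin 2) 4 where
  label
    | .bd i => ![0, 1, 1, 0] i
  two_ends := by
    intro e
    fin_cases e
    · refine ⟨.bd 0, .bd 3, by simp, ?_⟩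
      rintro (c | c | c)
      · exact c.elim
      · exact c.elim
      · fin_cases c <;> simp
    · refine ⟨.bd 1, .bd 2, by simp, ?_⟩
      rintro (c | c | c)
      · exact c.elim
      · exact c.elim
      · fin_cases c <;> simp

/-- `o₂` is obtained from `o₁` by reversing precisely the components in `K`: this compares
orientations of two diagrams that are identical outside the disk. -/
def Reverses {T : Tangle X P E 4} {I : Tangle X' P' E' 4} {J : Tangle X'' P'' E'' 4}
    (o₁ : (T.glue I).Orientation) (K : Set (T.glue I).Component)
    (o₂ : (T.glue J).Orientation) : Prop :=
  ∀ d : Dart X P 4, o₂.out (outer X'' P'' d) = o₁.out (outer X' P' d) ↔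
    (T.glue I).component (.inl (T.label d)) ∉ K

end Tangle

end LinkTheory

/-! Expand the Jones polynomial of the twisted diagram as a Kauffman state sum and fix the
smoothings outside the disk. A-smoothing a twist crossing leaves two vertical arcs; B-smoothing it
cuts the twist horizontally. The state without B-smoothings in the disk therefore looks like `L`,
while a state with `b > 0` of them looks from outside like `L_∞` and has `b - 1` extra circles. With
`δ = -√t - 1/√t`, the latter states together carry the factor `(1 + √t δ) ^ k - 1 = (-t) ^ k - 1 =
0`; taking out this factor requires `δ ≠ 0`, that is, `t ≠ -1`. So the two state sums agree
(`stateSum_glue_twist`), and the Jones values differ only by the normalizing factor, which depends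
on the writhe and the number of crossings (`jonesAt_glue_twist`).

The writhe is controlled as follows. Reversing `Lᵢ` flips the crossings of `Lᵢ` with the rest, which
changes the writhe by `-4λ` (`Reverses.sign_outside`, `two_mul_lk`). The twist adds `k` if its
strands become parallel, as in (i), and `-k` if they are antiparallel, as in (ii) (`sign_twist`).
The exponents of `√t` are then `k - 6λ` and `-2k - 6λ`.

Two points need topology. Since `lk` is an integer quotient, the number of crossings between `Lᵢ`
and the rest must be even. This is where planarity enters: by Euler's formula and linear algebra
over `ZMod 2`, the regions cut out by `Lᵢ` can be two-coloured (`Planar.exists_faceColouring`,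
`Planar.even_card_mixed`). And the outer strands must join neighbouring boundary points; this
follows from the orientation alone (`boundary_component_cases`). -/

namespace LinkTheory

/-! ### Sums over darts -/

namespace Dart

/-- A dart is a slot at a crossing, at a marked point or on the boundary. -/
def equivSum (X P : Type*) (n : ℕ) : Dart X P n ≃ (X × Fin 4) ⊕ (P × Fin 2) ⊕ Fin n where
  toFun
    | .cr x s => .inl (x, s)
    | .pt p s => .inr (.inl (p, s))
    | .bd i => .inr (.inr i)
  invFun
    | .inl a => .cr a.1 a.2
    | .inr (.inl a) => .pt a.1 a.2
    | .inr (.inr i) => .bd i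
  left_inv := by rintro (_ | _ | _) <;> rfl
  right_inv := by rintro (_ | _ | _) <;> rfl

noncomputable instance {X P : Type*} {n : ℕ} [Fintype X] [Fintype P] : Fintype (Dart X P n) :=
  Fintype.ofEquiv _ (equivSum X P n).symm

theorem sum_eq {X P M : Type*} {n : ℕ} [Fintype X] [Fintype P] [AddCommMonoid M]
    (f : Dart X P n → M) :
    ∑ d, f d = ∑ x, ∑ s, f (.cr x s) + (∑ p, ∑ s, f (.pt p s) + ∑ i, f (.bd i)) := by
  rw [← (equivSum X P n).symm.sum_comp, Fintype.sum_sum_type, Fintype.sum_sum_type,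
    Fintype.sum_prod_type, Fintype.sum_prod_type]
  rfl

end Dart

namespace Tangle

variable {X P E X' P' E' X'' P'' E'' : Type*} {n : ℕ}

theorem eq_or_eq_of_label_eq (D : Tangle X P E n) {d d' c : Dart X P n} (hne : d ≠ d')
    (h : D.label d = D.label d') (hc : D.label c = D.label d) : c = d ∨ c = d' := by
  obtain ⟨a, b, hab, H⟩ := D.two_ends (D.label d)
  have h1 := (H d).1 rfl
  have h2 := (H d').1 h.symm
  have h3 := (H c).1 hc
  grind

/-- Every fibre of `label` consists of two darts. This is the double counting used below for
orientations, for ends of strands and for parity. -/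
theorem sum_darts_eq_sum_edges {M : Type*} [Fintype X] [Fintype P] [Fintype E] [AddCommMonoid M]
    (D : Tangle X P E n) (f : Dart X P n → M) (g : E → M)
    (h : ∀ d d', d ≠ d' → D.label d = D.label d' → f d + f d' = g (D.label d)) :
    ∑ d, f d = ∑ e, g e := by
  classical
  rw [← Finset.sum_fiberwise Finset.univ D.label f]
  refine Finset.sum_congr rfl fun e _ => ?_
  obtain ⟨a, b, hab, H⟩ := D.two_ends e
  have : Finset.univ.filter (fun d => D.label d = e) = {a, b} := by
    ext c; simp [H]
  have ha := (H a).2 (.inl rfl)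
  rw [this, Finset.sum_pair hab, h a b hab (ha.trans ((H b).2 (.inr rfl)).symm), ha]

/-! ### Strands of a tangle -/

theorem strand_apply_eq {α : Sort*} {D : Tangle X P E n} {f : E → α}
    (hf : ∀ e e', D.StrandRel e e' → f e = f e') {e e' : E}
    (h : D.component e = D.component e') : f e = f e' :=
  congrArg (Quot.lift f hf) h

theorem component_under (D : Tangle X P E n) (x : X) :
    D.component (D.label (.cr x 0)) = D.component (D.label (.cr x 2)) :=
  Quot.sound (.underStrand x)

theorem component_over (D : Tangle X P E n) (x : X) :
    D.component (D.label (.cr x 1)) = D.component (D.label (.cr x 3)) :=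
  Quot.sound (.overStrand x)

theorem component_point (D : Tangle X P E n) (p : P) :
    D.component (D.label (.pt p 0)) = D.component (D.label (.pt p 1)) :=
  Quot.sound (.point p)

/-- A set of edges that is a union of strands has as many boundary darts directed into the tangle
as out of it. -/
theorem sum_boundary_out_eq_zero [Finite X] [Finite P] [Finite E] {D : Tangle X P E n}
    (o : D.Orientation) (w : E → ℤ) (hw : ∀ e e', D.StrandRel e e' → w e = w e') :
    ∑ i, w (D.label (.bd i)) * (if o.out (.bd i) then 1 else -1) = 0 := by
  cases nonempty_fintype X
  cases nonempty_fintype P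
  cases nonempty_fintype E
  -- The signs cancel at the two ends of each edge, and also at opposite slots of each crossing or
  -- marked point, so only the boundary terms survive.
  have h := D.sum_darts_eq_sum_edges (fun d => w (D.label d) * (if o.out d then 1 else -1 : ℤ))
    (fun _ => 0) fun d d' hne hl => by
      rw [o.edge d d' hne hl, ← hl]; cases o.out d <;> simp
  rw [Dart.sum_eq, Finset.sum_eq_zero, Finset.sum_eq_zero, zero_add, zero_add] at h
  · simpa using h
  · intro p _
    rw [Fin.sum_univ_two, o.point, hw _ _ (.point p)]
    cases o.out (.pt p 0) <;> simp
  · intro x _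
    rw [Fin.sum_univ_four, o.underStrand, o.overStrand, hw _ _ (.underStrand x),
      hw _ _ (.overStrand x)]
    cases o.out (.cr x 0) <;> cases o.out (.cr x 1) <;> simp

/-- A connected graph with vertices `V` and edges `J` has at most `card J + 1` vertices. -/
theorem card_le_card_links_add_one {V J : Type*} [Finite V] [Finite J] (s t : J → V)
    (h : ∀ f : V → ℚ, (∀ j, f (s j) = f (t j)) → ∀ v v', f v = f v') :
    Nat.card V ≤ Nat.card J + 1 := by
  cases nonempty_fintype V
  cases nonempty_fintype J
  rcases isEmpty_or_nonempty V with _ | ⟨⟨v₀⟩⟩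
  · simp
  -- The coboundary map. By connectedness its kernel contains only constant functions, and its rank
  -- is at most the number of edges.
  let d : (V → ℚ) →ₗ[ℚ] (J → ℚ) :=
    { toFun := fun f j => f (s j) - f (t j)
      map_add' := fun f g => by ext j; simp; ring
      map_smul' := fun a f => by ext j; simp; ring }
  have h1 := d.finrank_range_add_finrank_ker
  have h2 : Module.finrank ℚ (LinearMap.range d) ≤ Fintype.card J := by
    simpa using Submodule.finrank_le (LinearMap.range d)
  have h3 : Module.finrank ℚ (LinearMap.ker d) ≤ 1 := by
    have := LinearMap.finrank_le_finrank_of_injective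
      (f := (LinearMap.proj v₀ : (V → ℚ) →ₗ[ℚ] ℚ) ∘ₗ (LinearMap.ker d).subtype) ?_
    · simpa using this
    · rintro ⟨f, hf⟩ ⟨g, hg⟩ hfg
      have hf' := h f fun j => sub_eq_zero.1 (congrFun (LinearMap.mem_ker.1 hf) j)
      have hg' := h g fun j => sub_eq_zero.1 (congrFun (LinearMap.mem_ker.1 hg) j)
      ext v
      have : f v₀ = g v₀ := hfg
      change f v = g v
      rw [hf' v v₀, hg' v v₀, this]
  rw [Module.finrank_pi] at h1
  simp only [Nat.card_eq_fintype_card]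
  omega

open Classical in
/-- A strand has at most two ends on the boundary. -/
theorem sum_boundary_component_le_two [Finite X] [Finite P] [Finite E] (D : Tangle X P E n)
    (q : D.Component) :
    ∑ i, (if D.component (D.label (.bd i)) = q then 1 else 0) ≤ 2 := by
  cases nonempty_fintype X
  cases nonempty_fintype P
  cases nonempty_fintype E
  have h := D.sum_darts_eq_sum_edges
    (fun d => if D.component (D.label d) = q then 1 else 0)
    (fun e => 2 * if D.component e = q then 1 else 0) fun d d' hne hl => by
      rw [← hl]; ring
  -- The strand `q` is a connected graph whose vertices are its edges `V` and whose links `J` are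
  -- its passages through crossings and points. Twice the size of `V` counts its darts, namely two
  -- for each link plus those on the boundary; now `card V ≤ card J + 1` bounds the latter by 2.
  let J := {x : X // D.component (D.label (.cr x 0)) = q} ⊕
    {x : X // D.component (D.label (.cr x 1)) = q} ⊕
    {p : P // D.component (D.label (.pt p 0)) = q}
  let V := {e : E // D.component e = q}
  have hJ : Nat.card V ≤ Nat.card J + 1 := by
    refine card_le_card_links_add_one
      (Sum.elim (fun x => ⟨_, x.2⟩) (Sum.elim (fun x => ⟨_, x.2⟩) fun p => ⟨_, p.2⟩))
      (Sum.elim (fun x => ⟨_, (D.component_under x.1).symm.trans x.2⟩)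
        (Sum.elim (fun x => ⟨_, (D.component_over x.1).symm.trans x.2⟩)
          fun p => ⟨_, (D.component_point p.1).symm.trans p.2⟩)) fun f hf v v' => ?_
    let g : E → ℚ := fun e => if h : D.component e = q then f ⟨e, h⟩ else 0
    have hg : ∀ e e', D.StrandRel e e' → g e = g e' := by
      intro e e' hee
      have hc : D.component e = D.component e' := Quot.sound hee
      by_cases he : D.component e = q
      · have he' := hc ▸ he
        simp only [g, he, he', dif_pos]
        cases hee with
        | underStrand x => exact hf (.inl ⟨x, he⟩)
        | overStrand x => exact hf (.inr (.inl ⟨x, he⟩))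
        | point p => exact hf (.inr (.inr ⟨p, he⟩))
      · have he' : D.component e' ≠ q := hc ▸ he
        simp [g, he, he']
    have := strand_apply_eq hg (v.2.trans v'.2.symm)
    simpa [g, v.2, v'.2] using this
  rw [Dart.sum_eq, ← Finset.mul_sum] at h
  simp only [Fin.sum_univ_four, Fin.sum_univ_two, ← component_under, ← component_over,
    ← component_point, Finset.sum_add_distrib] at h
  simp only [J, V, Nat.card_eq_fintype_card, Fintype.card_sum, Fintype.card_subtype,
    Finset.card_filter] at hJ
  omega

/-- The strands of an oriented tangle whose four boundary points are directed alternately in and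
out join each boundary point with one of its two neighbours. -/
theorem boundary_component_cases [Finite X] [Finite P] [Finite E] {D : Tangle X P E 4}
    (o : D.Orientation) (h01 : o.out (.bd 1) = !o.out (.bd 0))
    (h02 : o.out (.bd 2) = o.out (.bd 0)) (h03 : o.out (.bd 3) = !o.out (.bd 0)) :
    (D.component (D.label (.bd 0)) = D.component (D.label (.bd 1)) ∧
      D.component (D.label (.bd 2)) = D.component (D.label (.bd 3)) ∧
      D.component (D.label (.bd 0)) ≠ D.component (D.label (.bd 2))) ∨
    (D.component (D.label (.bd 0)) = D.component (D.label (.bd 3)) ∧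
      D.component (D.label (.bd 1)) = D.component (D.label (.bd 2)) ∧
      D.component (D.label (.bd 0)) ≠ D.component (D.label (.bd 1))) := by
  classical
  -- A strand that reaches the boundary has at most two ends there, and as many directed in as out.
  -- So it joins two oppositely directed points, which are neighbours because the directions
  -- alternate.
  have key (q : D.Component) := And.intro (D.sum_boundary_component_le_two q)
    (sum_boundary_out_eq_zero o (fun e => if D.component e = q then 1 else 0) fun e e' h => by
      rw [show D.component e = D.component e' from Quot.sound h])
  have k0 := key (D.component (D.label (.bd 0)))
  have k2 := key (D.component (D.label (.bd 2)))
  simp only [Fin.sum_univ_four, h01, h02, h03] at k0 k2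
  generalize D.component (D.label (.bd 0)) = q0 at *
  generalize D.component (D.label (.bd 1)) = q1 at *
  generalize D.component (D.label (.bd 2)) = q2 at *
  generalize D.component (D.label (.bd 3)) = q3 at *
  clear key h01 h02 h03
  cases o.out (.bd 0) <;> grind


/-! ### Face colourings of planar diagrams -/

/-- Rotation of a dart clockwise around its vertex. -/
def prev : Dart X P n → Dart X P n
  | .cr x s => .cr x (s - 1)
  | .pt p s => .pt p (s - 1)
  | .bd i => .bd ((finRotate n).symm i)

theorem rot_prev (d : Dart X P n) : rot (prev d) = d := by
  rcases d with ⟨x, s⟩ | ⟨p, s⟩ | i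
  · simp [rot, prev]
  · simp [rot, prev]
  · exact congrArg Dart.bd ((finRotate n).apply_symm_apply i)

theorem prev_rot (d : Dart X P n) : prev (rot d) = d := by
  rcases d with ⟨x, s⟩ | ⟨p, s⟩ | i
  · simp [rot, prev]
  · simp [rot, prev]
  · exact congrArg Dart.bd ((finRotate n).symm_apply_apply i)

/-- The vertex of a dart; the boundary counts as one vertex. -/
def vertex : Dart X P n → X ⊕ P ⊕ Unit
  | .cr x _ => .inl x
  | .pt p _ => .inr (.inl p)
  | .bd _ => .inr (.inr ())

theorem vertex_rot (d : Dart X P n) : vertex (rot d) = vertex d := by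
  rcases d with _ | _ | _ <;> rfl

theorem vertex_surjective [NeZero n] : Function.Surjective (vertex : Dart X P n → _) := by
  rintro (x | p | _)
  · exact ⟨.cr x 0, rfl⟩
  · exact ⟨.pt p 0, rfl⟩
  · exact ⟨.bd 0, rfl⟩

/-- The face of a corner. -/
def face (D : Tangle X P E n) (d : Dart X P n) : Quot D.FaceRel := Quot.mk _ d

theorem face_eq_face_prev (D : Tangle X P E n) {d d' : Dart X P n} (hne : d ≠ d')
    (h : D.label d = D.label d') : D.face d = D.face (prev d') :=
  Quot.sound ⟨by rw [rot_prev, h], by rwa [rot_prev]⟩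

theorem label_surjective (D : Tangle X P E n) : Function.Surjective D.label := fun e => by
  obtain ⟨a, _, _, h⟩ := D.two_ends e
  exact ⟨a, (h a).2 (.inl rfl)⟩

open Classical in
/-- The incidence matrix of vertices and edges over `ZMod 2`. -/
noncomputable def incidence [Fintype X] [Fintype P] (D : Tangle X P E n) :
    Matrix (X ⊕ P ⊕ Unit) E (ZMod 2) :=
  .of fun v e => ∑ d, if vertex d = v ∧ D.label d = e then 1 else 0

theorem incidence_mulVec [Fintype X] [Fintype P] [Fintype E] (D : Tangle X P E n)
    (χ : E → ZMod 2) (v : X ⊕ P ⊕ Unit) [DecidableEq (X ⊕ P ⊕ Unit)] :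
    D.incidence.mulVec χ v = ∑ d, if vertex d = v then χ (D.label d) else 0 := by
  classical
  simp only [Matrix.mulVec, dotProduct, incidence, Matrix.of_apply, Finset.sum_mul]
  rw [Finset.sum_comm]
  refine Finset.sum_congr rfl fun d _ => ?_
  by_cases h : vertex d = v <;> simp [h]

theorem incidence_transpose_mulVec [Fintype X] [Fintype P] [Fintype E] (D : Tangle X P E n)
    (g : X ⊕ P ⊕ Unit → ZMod 2) {d d' : Dart X P n} (hne : d ≠ d')
    (h : D.label d = D.label d') :
    D.incidence.transpose.mulVec g (D.label d) = g (vertex d) + g (vertex d') := by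
  classical
  simp only [Matrix.mulVec, dotProduct, incidence, Matrix.of_apply, Matrix.transpose_apply,
    Finset.sum_mul]
  rw [Finset.sum_comm]
  have (c : Dart X P n) : ∑ v, (if vertex c = v ∧ D.label c = D.label d then 1 else 0) * g v =
      if c = d ∨ c = d' then g (vertex c) else 0 := by
    have : D.label c = D.label d ↔ c = d ∨ c = d' :=
      ⟨D.eq_or_eq_of_label_eq hne h, by rintro (rfl | rfl); exacts [rfl, h.symm]⟩
    by_cases hc : c = d ∨ c = d' <;> simp [this, hc]
  simp only [this]
  rw [← Finset.sum_filter, show Finset.univ.filter (fun c => c = d ∨ c = d') = {d, d'} by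
    ext; simp, Finset.sum_pair hne]

/-- The edges at which a face colouring changes. -/
noncomputable def faceBoundary (D : Tangle X P E n) :
    (Quot D.FaceRel → ZMod 2) →ₗ[ZMod 2] (E → ZMod 2) where
  toFun c e :=
    c (D.face (D.label_surjective e).choose) + c (D.face (prev (D.label_surjective e).choose))
  map_add' c c' := by ext e; simp; ring
  map_smul' a c := by ext e; simp; ring

/-- Both ends of an edge see the same two faces, in opposite order, so the end chosen in
`faceBoundary` is immaterial. -/
theorem faceBoundary_label (D : Tangle X P E n) (c : Quot D.FaceRel → ZMod 2)
    (d : Dart X P n) :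
    D.faceBoundary c (D.label d) = c (D.face d) + c (D.face (prev d)) := by
  change c (D.face _) + c (D.face (prev _)) = _
  have h := (D.label_surjective (D.label d)).choose_spec
  generalize (D.label_surjective (D.label d)).choose = d' at h
  by_cases hd : d' = d
  · rw [hd]
  · rw [D.face_eq_face_prev hd h, D.face_eq_face_prev (Ne.symm hd) h.symm, add_comm]

/-- Going around a vertex, every corner occurs once as the corner after a dart and once as the
corner before one, so its colour cancels modulo 2. -/
theorem incidence_mulVec_faceBoundary [Fintype X] [Fintype P] [Fintype E] (D : Tangle X P E n)
    (c : Quot D.FaceRel → ZMod 2) : D.incidence.mulVec (D.faceBoundary c) = 0 := by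
  classical
  ext v
  rw [incidence_mulVec]
  simp only [faceBoundary_label, Pi.zero_apply]
  let ρ : Equiv.Perm (Dart X P n) := ⟨rot, prev, prev_rot, rot_prev⟩
  have h : ∑ d, (if vertex d = v then c (D.face (prev d)) else 0) =
      ∑ d, if vertex d = v then c (D.face d) else 0 := by
    rw [← Equiv.sum_comp ρ]
    refine Finset.sum_congr rfl fun d _ => ?_
    change (if vertex (rot d) = v then c (D.face (prev (rot d))) else 0) = _
    rw [vertex_rot, prev_rot]
  rw [← Finset.sum_filter] at h ⊢
  rw [← Finset.sum_filter] at h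
  rw [Finset.sum_add_distrib, h, CharTwo.add_self_eq_zero]

/-- In a planar diagram, a set of edges that has even degree at every vertex is the set of edges at
which some colouring of the faces with two colours changes. -/
theorem Planar.exists_faceColouring [Finite X] [Finite P] [Finite E] [NeZero n]
    {D : Tangle X P E n} (hD : D.Planar) (χ : E → ZMod 2)
    (hcr : ∀ x, ∑ s, χ (D.label (.cr x s)) = 0) (hpt : ∀ p, ∑ s, χ (D.label (.pt p s)) = 0)
    (hbd : ∑ i, χ (D.label (.bd i)) = 0) :
    ∃ f : Dart X P n → ZMod 2, (∀ d, f d + f (prev d) = χ (D.label d)) ∧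
      ∀ d d', d ≠ d' → D.label d = D.label d' → f d = f (prev d') := by
  classical
  cases nonempty_fintype X
  cases nonempty_fintype P
  cases nonempty_fintype E
  have : Finite (Quot D.FaceRel) := Quot.finite _
  have : Finite (Quot D.ConnRel) := Quot.finite _
  cases nonempty_fintype (Quot D.FaceRel)
  cases nonempty_fintype (Quot D.ConnRel)
  let M := D.incidence
  have hle : LinearMap.range D.faceBoundary ≤ LinearMap.ker M.mulVecLin := by
    rintro _ ⟨c, rfl⟩
    exact D.incidence_mulVec_faceBoundary c
  -- A colouring that changes nowhere is constant on connected components.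
  have hkerF : Module.finrank (ZMod 2) (LinearMap.ker D.faceBoundary) ≤
      Fintype.card (Quot D.ConnRel) := by
    have hconst (c : LinearMap.ker D.faceBoundary) (d d' : Dart X P n) (h : D.ConnRel d d') :
        c.1 (D.face d) = c.1 (D.face d') := by
      have hp (d) : c.1 (D.face d) = c.1 (D.face (prev d)) := by
        have := D.faceBoundary_label c.1 d
        rw [LinearMap.mem_ker.1 c.2] at this
        exact CharTwo.add_eq_zero.1 this.symm
      rcases h with rfl | h
      · rw [hp (rot d), prev_rot]
      · by_cases hd : d = d'
        · rw [hd]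
        · rw [D.face_eq_face_prev hd h, ← hp]
    let F : LinearMap.ker D.faceBoundary →ₗ[ZMod 2] (Quot D.ConnRel → ZMod 2) :=
      { toFun := fun c => Quot.lift (fun d => c.1 (D.face d)) (hconst c)
        map_add' := fun c c' => by ext ⟨d⟩; rfl
        map_smul' := fun a c => by ext ⟨d⟩; rfl }
    have := LinearMap.finrank_le_finrank_of_injective (f := F) fun c c' h => by
      ext ⟨d⟩
      exact congrFun h (Quot.mk _ d)
    simpa using this
  -- Dually, a function on vertices that takes equal values at the ends of every edge is constant on
  -- connected components; this bounds the corank of the incidence matrix.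
  have hkerV : Module.finrank (ZMod 2) (LinearMap.ker M.transpose.mulVecLin) ≤
      Fintype.card (Quot D.ConnRel) := by
    have hconst (g : LinearMap.ker M.transpose.mulVecLin) (d d' : Dart X P n)
        (h : D.ConnRel d d') : g.1 (vertex d) = g.1 (vertex d') := by
      rcases h with rfl | h
      · rw [vertex_rot]
      · by_cases hd : d = d'
        · rw [hd]
        · have := D.incidence_transpose_mulVec g.1 hd h
          rw [show D.incidence.transpose.mulVec g.1 = 0 from LinearMap.mem_ker.1 g.2] at this
          exact CharTwo.add_eq_zero.1 this.symm
    let F : LinearMap.ker M.transpose.mulVecLin →ₗ[ZMod 2] (Quot D.ConnRel → ZMod 2) :=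
      { toFun := fun g => Quot.lift (fun d => g.1 (vertex d)) (hconst g)
        map_add' := fun c c' => by ext ⟨d⟩; rfl
        map_smul' := fun a c => by ext ⟨d⟩; rfl }
    have := LinearMap.finrank_le_finrank_of_injective (f := F) fun g g' h => by
      ext v
      obtain ⟨d, rfl⟩ := vertex_surjective (n := n) v
      exact congrFun h (Quot.mk _ d)
    simpa using this
  have h1 := D.faceBoundary.finrank_range_add_finrank_ker
  have h2 := M.mulVecLin.finrank_range_add_finrank_ker
  have h3 := M.transpose.mulVecLin.finrank_range_add_finrank_ker
  have h4 : Module.finrank (ZMod 2) (LinearMap.range M.transpose.mulVecLin) =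
    Module.finrank (ZMod 2) (LinearMap.range M.mulVecLin) := M.rank_transpose
  have hD' : _ = _ := hD
  rw [Nat.min_eq_right (NeZero.one_le)] at hD'
  simp only [Module.finrank_pi, Fintype.card_sum, Fintype.card_unit, Nat.card_eq_fintype_card]
    at h1 h2 h3 hD'
  -- With `C` connected components, the boundaries have dimension at least `F - C`, and the cycles
  -- at most `E - V + C`. These bounds are equal by Euler's formula, so every cycle is a boundary.
  have heq := Submodule.eq_of_le_of_finrank_le hle (by omega)
  have hχ : χ ∈ LinearMap.ker M.mulVecLin := by
    rw [LinearMap.mem_ker]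
    ext v
    change M.mulVec χ v = 0
    rw [incidence_mulVec, Dart.sum_eq]
    rcases v with x | p | _
    · simp only [vertex, Sum.inl.injEq, reduceCtorEq, if_false, Finset.sum_const_zero, add_zero]
      rw [Finset.sum_eq_single x (by simp +contextual) (by simp)]
      simpa using hcr x
    · simp only [vertex, Sum.inr.injEq, Sum.inl.injEq, reduceCtorEq, if_false,
        Finset.sum_const_zero, add_zero, zero_add]
      rw [Finset.sum_eq_single p (by simp +contextual) (by simp)]
      simpa using hpt p
    · simpa [vertex] using hbd
  obtain ⟨c, hc⟩ := heq ▸ hχ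
  exact ⟨fun d => c (D.face d), fun d => by rw [← hc, faceBoundary_label],
    fun d d' hne h => congrArg c (D.face_eq_face_prev hne h)⟩

/-- The boundary vertex contributes nothing to the parity count below when neighbours are paired.
Under a diagonal pairing it would contribute `a + b`, like a crossing. -/
theorem sum_boundary_eq_zero_of_pairing {a b c d f0 f1 f2 f3 : ZMod 2}
    (h : (a = b ∧ c = d) ∨ (a = d ∧ b = c)) (ha : f0 + f3 = a) (hb : f1 + f0 = b)
    (hc : f2 + f1 = c) (hd : f3 + f2 = d) :
    (1 + a) * f0 + (1 + b) * f1 + (1 + c) * f2 + (1 + d) * f3 = 0 := by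
  subst ha hb hc hd
  revert f0 f1 f2 f3
  decide

/-- In a planar tangle with four boundary points, let `K` be a union of strands that contains two
neighbouring boundary points or none, and the same for the other two. Then the number of crossings
of strands in `K` with strands not in `K` is even. -/
theorem Planar.even_card_mixed [Fintype X] [Finite P] [Finite E] {T : Tangle X P E 4}
    (hT : T.Planar) (K : E → Prop) (hK : ∀ e e', T.StrandRel e e' → (K e ↔ K e'))
    (hbd : ((K (T.label (.bd 0)) ↔ K (T.label (.bd 1))) ∧
        (K (T.label (.bd 2)) ↔ K (T.label (.bd 3)))) ∨
      ((K (T.label (.bd 0)) ↔ K (T.label (.bd 3))) ∧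
        (K (T.label (.bd 1)) ↔ K (T.label (.bd 2)))))
    [DecidablePred fun x => ¬(K (T.label (.cr x 0)) ↔ K (T.label (.cr x 1)))] :
    Even (Finset.univ.filter fun x => ¬(K (T.label (.cr x 0)) ↔ K (T.label (.cr x 1)))).card := by
  classical
  cases nonempty_fintype P
  cases nonempty_fintype E
  obtain ⟨χ, χ_def⟩ : ∃ χ : E → ZMod 2, ∀ e, χ e = if K e then 1 else 0 := ⟨_, fun _ => rfl⟩
  have hχ (e e') (h : T.StrandRel e e') : χ e = χ e' := by simp only [χ_def, hK e e' h]
  have hbd' : (χ (T.label (.bd 0)) = χ (T.label (.bd 1)) ∧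
      χ (T.label (.bd 2)) = χ (T.label (.bd 3))) ∨
      (χ (T.label (.bd 0)) = χ (T.label (.bd 3)) ∧
        χ (T.label (.bd 1)) = χ (T.label (.bd 2))) := by
    simp only [χ_def]
    rcases hbd with ⟨h, h'⟩ | ⟨h, h'⟩
    · left; simp only [h, h', and_self]
    · right; simp only [h, h', and_self]
  obtain ⟨f, hf, hf'⟩ := hT.exists_faceColouring χ
    (fun x => by
      rw [Fin.sum_univ_four, ← hχ _ _ (.underStrand x), ← hχ _ _ (.overStrand x)]
      generalize χ _ = a; generalize χ _ = b; revert a b; decide)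
    (fun p => by
      rw [Fin.sum_univ_two, ← hχ _ _ (.point p)]
      generalize χ _ = a; revert a; decide)
    (by
      rw [Fin.sum_univ_four]
      rcases hbd' with ⟨h, h'⟩ | ⟨h, h'⟩ <;> rw [h, h'] <;>
      · generalize χ _ = a; generalize χ _ = b; revert a b; decide)
  -- Count the darts off `K` that lie in regions of colour 1. An edge off `K` has the same colour on
  -- both sides and at both ends, so the total is even. At a mixed crossing the two darts off `K`
  -- lie on opposite sides of `K` and contribute exactly one; all other vertices contribute an even
  -- number.
  have h := T.sum_darts_eq_sum_edges (fun d => (1 + χ (T.label d)) * f d) (fun _ => 0)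
    fun d d' hne hl => by
      rw [← hl]
      have h1 := hf d
      have h2 := hf' d' d hne.symm hl.symm
      rw [h2, ← mul_add, h1]
      generalize χ (T.label d) = a; revert a; decide
  have hcr (x : X) : ∑ s, (1 + χ (T.label (.cr x s))) * f (.cr x s) =
      if ¬(K (T.label (.cr x 0)) ↔ K (T.label (.cr x 1))) then 1 else 0 := by
    have h0 : f (.cr x 0) + f (.cr x 3) = _ := hf (.cr x 0)
    have h1 : f (.cr x 1) + f (.cr x 0) = _ := hf (.cr x 1)
    have h2 : f (.cr x 2) + f (.cr x 1) = _ := hf (.cr x 2)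
    have h3 : f (.cr x 3) + f (.cr x 2) = _ := hf (.cr x 3)
    rw [← hχ _ _ (.underStrand x)] at h2
    rw [← hχ _ _ (.overStrand x)] at h3
    rw [Fin.sum_univ_four, ← hχ _ _ (.underStrand x), ← hχ _ _ (.overStrand x)]
    have : (if ¬(K (T.label (.cr x 0)) ↔ K (T.label (.cr x 1))) then 1 else 0 : ZMod 2) =
        χ (T.label (.cr x 0)) + χ (T.label (.cr x 1)) := by
      simp only [χ_def]
      by_cases ha : K (T.label (.cr x 0)) <;> by_cases hb : K (T.label (.cr x 1)) <;>
        simp only [ha, hb, not_true_eq_false, not_false_eq_true, iff_self, iff_false, iff_true,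
          if_true, if_false] <;> decide
    rw [this]
    have key : ∀ a b f0 f1 f2 f3 : ZMod 2, f0 + f3 = a → f1 + f0 = b → f2 + f1 = a →
        f3 + f2 = b →
        (1 + a) * f0 + (1 + b) * f1 + (1 + a) * f2 + (1 + b) * f3 = a + b := by decide
    exact key _ _ _ _ _ _ h0 h1 h2 h3
  have hpt (p : P) : ∑ s, (1 + χ (T.label (.pt p s))) * f (.pt p s) = 0 := by
    have h0 : f (.pt p 0) + f (.pt p 1) = _ := hf (.pt p 0)
    rw [Fin.sum_univ_two, ← hχ _ _ (.point p)]
    have key : ∀ a f0 f1 : ZMod 2, f0 + f1 = a → (1 + a) * f0 + (1 + a) * f1 = 0 := by decide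
    exact key _ _ _ h0
  have hb : ∑ i, (1 + χ (T.label (.bd i))) * f (.bd i) = 0 := by
    have h0 : f (.bd 0) + f (.bd 3) = _ := hf (.bd 0)
    have h1 : f (.bd 1) + f (.bd 0) = _ := hf (.bd 1)
    have h2 : f (.bd 2) + f (.bd 1) = _ := hf (.bd 2)
    have h3 : f (.bd 3) + f (.bd 2) = _ := hf (.bd 3)
    rw [Fin.sum_univ_four]
    exact sum_boundary_eq_zero_of_pairing hbd' h0 h1 h2 h3
  rw [Dart.sum_eq, hb, Finset.sum_congr rfl fun x _ => hcr x,
    Finset.sum_congr rfl fun p _ => hpt p] at h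
  simp only [Finset.sum_const_zero, add_zero, Finset.sum_boole] at h
  exact (ZMod.natCast_eq_zero_iff_even).1 h


/-! ### Classes of edges of a glued diagram -/

/-- The relation on `E ⊕ E'` generated by `R` on `E`, `R'` on `E'` and four links between them. -/
inductive GlueRel (R : E → E → Prop) (R' : E' → E' → Prop) (β : Fin 4 → E) (β' : Fin 4 → E') :
    E ⊕ E' → E ⊕ E' → Prop
  | outer {a b} (h : R a b) : GlueRel R R' β β' (.inl a) (.inl b)
  | inner {a b} (h : R' a b) : GlueRel R R' β β' (.inr a) (.inr b)
  | link (i) : GlueRel R R' β β' (.inl (β i)) (.inr (β' i))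

/-- The relation generated by `R` and the identification of those `β i` that have the same value
of `v`. -/
inductive JoinRel (R : E → E → Prop) (β : Fin 4 → E) (v : Fin 4 → Bool) : E → E → Prop
  | base {a b} (h : R a b) : JoinRel R β v a b
  | join (i j) (h : v i = v j) : JoinRel R β v (β i) (β j)

/-- The edges of a tangle at the boundary points. -/
def boundary (T : Tangle X P E n) (i : Fin n) : E := T.label (.bd i)

theorem stateRel_glue (T : Tangle X P E 4) (I : Tangle X' P' E' 4) (A : Finset X)
    (B : Finset X') : (T.glue I).StateRel (A.disjSum B) =
      GlueRel (T.StateRel A) (I.StateRel B) T.boundary I.boundary := by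
  ext a b
  constructor
  · rintro (⟨x | x, h⟩ | ⟨x | x, h⟩ | ⟨x | x, h⟩ | ⟨x | x, h⟩ | ⟨p | p | i⟩)
    · exact .outer (.a₁ x (by simpa using h))
    · exact .inner (.a₁ x (by simpa using h))
    · exact .outer (.a₂ x (by simpa using h))
    · exact .inner (.a₂ x (by simpa using h))
    · exact .outer (.b₁ x (by simpa using h))
    · exact .inner (.b₁ x (by simpa using h))
    · exact .outer (.b₂ x (by simpa using h))
    · exact .inner (.b₂ x (by simpa using h))
    · exact .outer (.point p)
    · exact .inner (.point p)
    · exact .link i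
  · rintro (⟨⟨x, h⟩ | ⟨x, h⟩ | ⟨x, h⟩ | ⟨x, h⟩ | ⟨p⟩⟩ | ⟨⟨x, h⟩ | ⟨x, h⟩ | ⟨x, h⟩ | ⟨x, h⟩ | ⟨p⟩⟩ | i)
    · exact .a₁ (D := T.glue I) (.inl x) (by simpa using h)
    · exact .a₂ (D := T.glue I) (.inl x) (by simpa using h)
    · exact .b₁ (D := T.glue I) (.inl x) (by simpa using h)
    · exact .b₂ (D := T.glue I) (.inl x) (by simpa using h)
    · exact .point (D := T.glue I) (.inl p)
    · exact .a₁ (D := T.glue I) (.inr x) (by simpa using h)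
    · exact .a₂ (D := T.glue I) (.inr x) (by simpa using h)
    · exact .b₁ (D := T.glue I) (.inr x) (by simpa using h)
    · exact .b₂ (D := T.glue I) (.inr x) (by simpa using h)
    · exact .point (D := T.glue I) (.inr (.inl p))
    · exact .point (D := T.glue I) (.inr (.inr i))

theorem strandRel_glue (T : Tangle X P E 4) (I : Tangle X' P' E' 4) :
    (T.glue I).StrandRel = GlueRel T.StrandRel I.StrandRel T.boundary I.boundary := by
  ext a b
  constructor
  · rintro (⟨x | x⟩ | ⟨x | x⟩ | ⟨p | p | i⟩)
    · exact .outer (.underStrand x)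
    · exact .inner (.underStrand x)
    · exact .outer (.overStrand x)
    · exact .inner (.overStrand x)
    · exact .outer (.point p)
    · exact .inner (.point p)
    · exact .link i
  · rintro (⟨⟨x⟩ | ⟨x⟩ | ⟨p⟩⟩ | ⟨⟨x⟩ | ⟨x⟩ | ⟨p⟩⟩ | i)
    · exact .underStrand (D := T.glue I) (.inl x)
    · exact .overStrand (D := T.glue I) (.inl x)
    · exact .point (D := T.glue I) (.inl p)
    · exact .underStrand (D := T.glue I) (.inr x)
    · exact .overStrand (D := T.glue I) (.inr x)
    · exact .point (D := T.glue I) (.inr (.inl p))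
    · exact .point (D := T.glue I) (.inr (.inr i))

/-- `φ` classifies the curves inside the disk. Those that reach the boundary only identify outer
classes, in the pattern recorded by `v`; the others are closed inside and are counted separately.
This serves both for state curves and for link components. -/
theorem card_quot_glueRel {γ : Type*} [Finite E] [Finite γ] {R : E → E → Prop}
    {R' : E' → E' → Prop} {β : Fin 4 → E} {β' : Fin 4 → E'} (φ : E' → γ)
    (hsurj : Function.Surjective φ) (hR : ∀ a b, R' a b → φ a = φ b)
    (hinj : ∀ a b, φ a = φ b → Quot.mk R' a = Quot.mk R' b) (v : Fin 4 → Bool)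
    (hv : ∀ i j, φ (β' i) = φ (β' j) ↔ v i = v j) :
    Nat.card (Quot (GlueRel R R' β β')) =
      Nat.card (Quot (JoinRel R β v)) + Nat.card {c : γ // ∀ i, φ (β' i) ≠ c} := by
  classical
  have hinj' (a b) (h : φ a = φ b) : Quot.mk (GlueRel R R' β β') (.inr a) = Quot.mk _ (.inr b) :=
    congrArg (Quot.lift (fun e => Quot.mk (GlueRel R R' β β') (.inr e))
      fun _ _ h => Quot.sound (.inner h)) (hinj a b h)
  let F : E' → Quot (JoinRel R β v) ⊕ {c : γ // ∀ i, φ (β' i) ≠ c} := fun a =>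
    if h : ∃ i, φ (β' i) = φ a then .inl (Quot.mk _ (β h.choose))
    else .inr ⟨φ a, not_exists.1 h⟩
  have hF (i) : F (β' i) = .inl (Quot.mk _ (β i)) := by
    have h : ∃ j, φ (β' j) = φ (β' i) := ⟨i, rfl⟩
    simp only [F, dif_pos h]
    exact congrArg Sum.inl (Quot.sound (.join _ _ ((hv _ _).1 h.choose_spec)))
  have hF' (a b) (h : φ a = φ b) : F a = F b := by simp only [F, h]
  rw [← Nat.card_sum]
  refine Nat.card_congr ⟨Quot.lift (Sum.elim (fun e => .inl (Quot.mk _ e)) F) ?_,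
    Sum.elim (Quot.lift (fun e => Quot.mk _ (.inl e)) ?_)
      (fun c => Quot.mk _ (.inr (hsurj c.1).choose)), ?_, ?_⟩
  · rintro _ _ (h | h | i)
    · exact congrArg Sum.inl (Quot.sound (.base h))
    · exact hF' _ _ (hR _ _ h)
    · exact (hF i).symm
  · rintro _ _ (h | ⟨i, j, h⟩)
    · exact Quot.sound (.outer h)
    · exact (Quot.sound (.link i)).trans
        ((hinj' _ _ ((hv i j).2 h)).trans (Quot.sound (.link j)).symm)
  · rintro ⟨e | a⟩
    · rfl
    · change Sum.elim _ _ (F a) = Quot.mk _ (Sum.inr a)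
      by_cases h : ∃ i, φ (β' i) = φ a
      · simp only [F, dif_pos h]
        exact (Quot.sound (.link _)).trans (hinj' _ _ h.choose_spec)
      · simp only [F, dif_neg h]
        exact hinj' _ _ (hsurj _).choose_spec
  · rintro (q | ⟨c, hc⟩)
    · induction q using Quot.ind
      rfl
    · change F _ = _
      have h := (hsurj c).choose_spec
      rw [← h] at hc
      simp only [F]
      rw [dif_neg (not_exists.2 hc)]
      simp [h]

theorem card_quot_joinRel_of_eq {R : E → E → Prop} {β : Fin 4 → E} {v : Fin 4 → Bool}
    (h : ∀ i j, v i = v j → Quot.mk R (β i) = Quot.mk R (β j)) :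
    Nat.card (Quot (JoinRel R β v)) = Nat.card (Quot R) := by
  refine Nat.card_congr ⟨Quot.lift (Quot.mk R) ?_, Quot.map id fun a b h => .base h, ?_, ?_⟩
  · rintro _ _ (h' | ⟨i, j, hij⟩)
    · exact Quot.sound h'
    · exact h i j hij
  · rintro ⟨a⟩; rfl
  · rintro ⟨a⟩; rfl

/-- All boundary points lie in two classes, and the joins merge exactly these two into one. -/
theorem card_quot_joinRel_of_ne [Finite E] {R : E → E → Prop} {β : Fin 4 → E}
    {v : Fin 4 → Bool} (i₀ j₀ : Fin 4) (hv : v i₀ = v j₀)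
    (hne : Quot.mk R (β i₀) ≠ Quot.mk R (β j₀))
    (h : ∀ i, Quot.mk R (β i) = Quot.mk R (β i₀) ∨ Quot.mk R (β i) = Quot.mk R (β j₀)) :
    Nat.card (Quot (JoinRel R β v)) + 1 = Nat.card (Quot R) := by
  classical
  have : Finite (Quot R) := Quot.finite _
  let N := {q : Quot R // q ≠ Quot.mk R (β j₀)}
  let F : Quot R → N := fun q => if h : q = Quot.mk R (β j₀) then ⟨_, hne⟩ else ⟨q, h⟩
  have hF (i) : F (Quot.mk R (β i)) = ⟨_, hne⟩ := by
    rcases h i with h | h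
    · simp [F, h, hne]
    · simp [F, h]
  have e : Quot (JoinRel R β v) ≃ N :=
    { toFun := Quot.lift (fun a => F (Quot.mk R a)) (by
        rintro _ _ (h' | ⟨i, j, hij⟩)
        · exact congrArg F (Quot.sound h')
        · rw [hF, hF])
      invFun := fun q => Quot.map (ra := R) id (fun a b h => .base h) q.1
      left_inv := by
        rintro ⟨a⟩
        change Quot.map id _ (F (Quot.mk R a)).1 = Quot.mk _ a
        by_cases ha : Quot.mk R a = Quot.mk R (β j₀)
        · simp only [F, dif_pos ha]
          exact (Quot.sound (.join i₀ j₀ hv)).trans (congrArg (Quot.map (ra := R)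
            (rb := JoinRel R β v) id fun a b h => .base h) ha).symm
        · simp only [F, dif_neg ha]; rfl
      right_inv := by
        rintro ⟨⟨a⟩, ha⟩
        change F (Quot.mk R a) = _
        simp only [F, dif_neg ha] }
  rw [Nat.card_congr e, ← Finite.card_option, Nat.card_congr (Equiv.optionSubtypeNe _)]

/-! ### The states and strands of a twist -/

/-- The number of `B`-smoothed crossings of the twist below a level. -/
def belowCount {k : ℕ} (B : Finset (Fin k)) (l : ℕ) : ℕ := (B.filter fun b => b.val < l).card

theorem belowCount_zero {k : ℕ} (B : Finset (Fin k)) : belowCount B 0 = 0 := by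
  simp [belowCount]

theorem belowCount_last {k : ℕ} (B : Finset (Fin k)) : belowCount B k = B.card := by
  simp [belowCount]

theorem belowCount_mono {k : ℕ} (B : Finset (Fin k)) : Monotone (belowCount B) := fun _ _ h =>
  Finset.card_le_card (Finset.monotone_filter_right _ fun _ _ hb => lt_of_lt_of_le hb h)

theorem belowCount_lt {k : ℕ} {B : Finset (Fin k)} {b : Fin k} (hb : b ∈ B) {l l' : ℕ}
    (hl : l ≤ b) (hl' : b < l') : belowCount B l < belowCount B l' := by
  refine Finset.card_lt_card (Finset.ssubset_iff_of_subset ?_ |>.2 ⟨b, ?_, ?_⟩)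
  · exact Finset.monotone_filter_right _ fun _ _ h => by omega
  · simp [hb, hl']
  · simp [hl]

theorem belowCount_succ_le {k : ℕ} (B : Finset (Fin k)) (l : ℕ) :
    belowCount B (l + 1) ≤ belowCount B l + 1 := by
  by_cases h : l < k
  · refine (Finset.card_le_card (t := insert ⟨l, h⟩ (B.filter fun b => b.val < l)) ?_).trans
      (Finset.card_insert_le _ _)
    intro b hb
    simp only [Finset.mem_filter, Finset.mem_insert, Fin.ext_iff] at hb ⊢
    rcases Nat.lt_succ_iff_lt_or_eq.1 hb.2 with h' | h'
    exacts [.inr ⟨hb.1, h'⟩, .inl h']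
  · refine (Finset.card_le_card ?_).trans (Nat.le_succ _)
    intro b hb
    have := b.2
    simp only [Finset.mem_filter] at hb ⊢
    exact ⟨hb.1, by omega⟩

theorem belowCount_succ_of_notMem {k : ℕ} {B : Finset (Fin k)} {b : Fin k} (hb : b ∉ B) :
    belowCount B (b + 1) = belowCount B b := by
  refine congrArg Finset.card (Finset.filter_congr fun c hc => ?_)
  have : c ≠ b := fun h => hb (h ▸ hc)
  rw [Ne, Fin.ext_iff] at this
  omega

/-- Discrete intermediate values: the count starts at 0 and grows by at most 1 per level. -/
theorem exists_belowCount_eq {k : ℕ} (B : Finset (Fin k)) (i : ℕ) (m : ℕ)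
    (h : i ≤ belowCount B m) : ∃ l ≤ m, belowCount B l = i := by
  induction m with
  | zero => exact ⟨0, le_rfl, by rw [belowCount_zero] at h ⊢; omega⟩
  | succ m ih =>
    by_cases h' : i ≤ belowCount B m
    · obtain ⟨l, hl, h⟩ := ih h'
      exact ⟨l, by omega, h⟩
    · exact ⟨m + 1, le_rfl, by have := belowCount_succ_le B m; omega⟩

/-- The class of an edge of a twist in a state. -/
def twistClass {k : ℕ} (B : Finset (Fin k)) (l : Fin (k + 1)) (s : Bool) :
    Quot ((twist k).StateRel B) := Quot.mk _ (l, s)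

theorem twistClass_succ {k : ℕ} {B : Finset (Fin k)} {x : Fin k} (hx : x ∉ B) (s : Bool) :
    twistClass B x.castSucc s = twistClass B x.succ s := by
  cases s
  · exact (Quot.sound (.a₂ (D := twist k) x hx)).symm
  · exact Quot.sound (.a₁ (D := twist k) x hx)

theorem twistClass_castSucc_of_mem {k : ℕ} {B : Finset (Fin k)} {x : Fin k} (hx : x ∈ B)
    (s s' : Bool) : twistClass B x.castSucc s = twistClass B x.castSucc s' := by
  have : twistClass B x.castSucc false = twistClass B x.castSucc true :=
    Quot.sound (.b₂ (D := twist k) x hx)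
  cases s <;> cases s' <;> simp [this]

theorem twistClass_succ_of_mem {k : ℕ} {B : Finset (Fin k)} {x : Fin k} (hx : x ∈ B)
    (s s' : Bool) : twistClass B x.succ s = twistClass B x.succ s' := by
  have : twistClass B x.succ true = twistClass B x.succ false :=
    Quot.sound (.b₁ (D := twist k) x hx)
  cases s <;> cases s' <;> simp [this]

theorem twistClass_eq_of_le {k : ℕ} {B : Finset (Fin k)} (l l' : ℕ) (hll : l ≤ l')
    (hl' : l' < k + 1) (h : ∀ b ∈ B, ¬(l ≤ b.val ∧ b.val < l')) (s : Bool) :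
    twistClass B ⟨l, by omega⟩ s = twistClass B ⟨l', hl'⟩ s := by
  induction l', hll using Nat.le_induction with
  | base => rfl
  | succ m hm ih =>
    rw [ih (by omega) fun b hb hb' => h b hb ⟨hb'.1, by omega⟩]
    exact twistClass_succ (x := ⟨m, by omega⟩) (fun hx => h _ hx ⟨hm, by simp⟩) s

theorem twistClass_eq_of_nonempty {k : ℕ} {B : Finset (Fin k)} (hB : B.Nonempty)
    (l : Fin (k + 1)) (s s' : Bool) : twistClass B l s = twistClass B l s' := by
  -- Left and right are joined at the lowest B-smoothed crossing above the level, or, if there is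
  -- none, at the highest one below it. The A-smoothings in between only continue both sides
  -- vertically.
  by_cases h : (B.filter fun b => l.val ≤ b.val).Nonempty
  · obtain ⟨b, hb, hmin⟩ : ∃ b, b ∈ B.filter (fun b => l.val ≤ b.val) ∧
        ∀ c ∈ B.filter (fun b => l.val ≤ b.val), b ≤ c :=
      ⟨_, Finset.min'_mem _ h, Finset.min'_le _⟩
    simp only [Finset.mem_filter] at hb hmin
    have := fun s => twistClass_eq_of_le (B := B) l b hb.2 (by omega)
      (fun c hc hc' => by have := Fin.le_iff_val_le_val.1 (hmin c ⟨hc, hc'.1⟩); omega) s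
    exact (this s).trans ((twistClass_castSucc_of_mem hb.1 s s').trans (this s').symm)
  · have hlt : ∀ b ∈ B, b.val < l := fun b hb => by
      by_contra hb'
      exact h ⟨b, by simpa [hb] using hb'⟩
    obtain ⟨b, hb, hmax⟩ : ∃ b, b ∈ B ∧ ∀ c ∈ B, c ≤ b :=
      ⟨_, Finset.max'_mem B hB, B.le_max'⟩
    have := fun s => twistClass_eq_of_le (B := B) (b + 1) l (hlt b hb) l.2
      (fun c hc hc' => by have := Fin.le_iff_val_le_val.1 (hmax c hc); omega) s
    exact (this s).symm.trans ((twistClass_succ_of_mem hb s s').trans (this s'))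

theorem twistClass_eq_of_belowCount_eq {k : ℕ} {B : Finset (Fin k)} (hB : B.Nonempty)
    (l l' : Fin (k + 1)) (s s' : Bool) (h : belowCount B l = belowCount B l') :
    twistClass B l s = twistClass B l' s' := by
  wlog hll : l ≤ l' generalizing l l' s s'
  · exact (this l' l s' s h.symm (le_of_not_ge hll)).symm
  rw [twistClass_eq_of_nonempty hB l' s' s]
  exact twistClass_eq_of_le l l' hll l'.2 (fun b hb hb' =>
    (belowCount_lt hb hb'.1 hb'.2).ne h) s

/-- The boundary points on the right side. -/
def rightSide : Fin 4 → Bool := ![true, true, false, false]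

/-- The boundary points on the upper side. -/
def upperSide : Fin 4 → Bool := ![false, true, true, false]

/-- The boundary points on the diagonal from SE to NW. -/
def diagonal : Fin 4 → Bool := ![true, false, true, false]

theorem twist_boundary_snd_eq_iff (k : ℕ) (i j : Fin 4) :
    ((twist k).boundary i).2 = ((twist k).boundary j).2 ↔ rightSide i = rightSide j := by
  fin_cases i <;> fin_cases j <;> simp [boundary, twist, twistLabel, rightSide]

/-- With A-smoothings only, the twist becomes two vertical arcs. The count does not depend on `k`,
so this state matches the one of the untwisted diagram. -/
theorem loops_glue_twist_empty [Finite E] (T : Tangle X P E 4) (A : Finset X) (k : ℕ) :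
    (T.glue (twist k)).loops (A.disjSum ∅) =
      Nat.card (Quot (JoinRel (T.StateRel A) T.boundary rightSide)) := by
  rw [loops, stateRel_glue, card_quot_glueRel (γ := Bool) Prod.snd (fun s => ⟨(0, s), rfl⟩) ?_ ?_
    rightSide (twist_boundary_snd_eq_iff _)]
  · rw [Nat.add_eq_left]
    have : IsEmpty {c : Bool // ∀ i, ((twist k).boundary i).2 ≠ c} := by
      refine ⟨fun ⟨c, hc⟩ => ?_⟩
      cases c
      · exact hc 2 rfl
      · exact hc 0 rfl
    exact Nat.card_of_isEmpty
  · rintro _ _ (⟨x, h⟩ | ⟨x, h⟩ | ⟨x, h⟩ | ⟨x, h⟩ | ⟨⟨⟩⟩)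
    · rfl
    · rfl
    · simp at h
    · simp at h
  · rintro ⟨l, s⟩ ⟨l', s'⟩ rfl
    have := fun l : Fin (k + 1) => twistClass_eq_of_le (B := ∅) 0 l (Nat.zero_le _) l.2 (by simp) s
    exact (this l).symm.trans (this l')

/-- The B-smoothed crossings separate the twist into `B.card + 1` pieces, classified by
`belowCount`. The lowest and the highest are the arcs of `smoothing`; the other `B.card - 1` are
circles. -/
theorem loops_glue_twist_nonempty [Finite E] (T : Tangle X P E 4) (A : Finset X) {k : ℕ}
    {B : Finset (Fin k)} (hB : B.Nonempty) :
    (T.glue (twist k)).loops (A.disjSum B) =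
      Nat.card (Quot (JoinRel (T.StateRel A) T.boundary upperSide)) + (B.card - 1) := by
  have hpos := hB.card_pos
  have hle (l : Fin (k + 1)) : belowCount B l < B.card + 1 := by
    have := belowCount_mono B (Nat.lt_succ_iff.1 l.2)
    rw [belowCount_last] at this
    omega
  let φ : Fin (k + 1) × Bool → Fin (B.card + 1) := fun e => ⟨belowCount B e.1, hle e.1⟩
  have hβ (i) : φ ((twist k).boundary i) = if upperSide i then Fin.last _ else 0 := by
    have h0 : φ (0, true) = 0 := Fin.ext (belowCount_zero B)
    have h1 : φ (Fin.last k, true) = Fin.last _ := Fin.ext (belowCount_last B)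
    fin_cases i
    exacts [h0, h1, h1, h0]
  have hlast : Fin.last B.card ≠ 0 := by
    rw [Ne, Fin.ext_iff]; simpa using hpos.ne'
  rw [loops, stateRel_glue, card_quot_glueRel φ ?_ ?_ ?_ upperSide ?_]
  · congr 1
    have : {c : Fin (B.card + 1) | ∀ i, φ ((twist k).boundary i) ≠ c} =
        ({0, Fin.last _} : Finset (Fin (B.card + 1)))ᶜ := by
      ext c
      simp only [hβ, Set.mem_ofPred_eq, Finset.coe_compl, Set.mem_compl_iff, Finset.mem_coe,
        Finset.mem_insert, Finset.mem_singleton, not_or]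
      refine ⟨fun h => ⟨fun hc => h 0 hc.symm, fun hc => h 1 hc.symm⟩, fun h i => ?_⟩
      split_ifs
      exacts [Ne.symm h.2, Ne.symm h.1]
    change Nat.card ({c : Fin (B.card + 1) | ∀ i, φ ((twist k).boundary i) ≠ c} : Set _) = _
    rw [this, Nat.card_eq_card_toFinset, Finset.toFinset_coe, Finset.card_compl,
      Finset.card_pair hlast.symm, Fintype.card_fin]
    omega
  · intro c
    obtain ⟨l, hl, h⟩ := exists_belowCount_eq B c k
      (by rw [belowCount_last]; exact Nat.lt_succ_iff.1 c.2)
    exact ⟨(⟨l, by omega⟩, true), Fin.ext h⟩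
  · rintro _ _ (⟨x, h⟩ | ⟨x, h⟩ | ⟨x, h⟩ | ⟨x, h⟩ | ⟨⟨⟩⟩)
    · exact Fin.ext (belowCount_succ_of_notMem h).symm
    · exact Fin.ext (belowCount_succ_of_notMem h)
    · rfl
    · rfl
  · rintro ⟨l, s⟩ ⟨l', s'⟩ h
    exact twistClass_eq_of_belowCount_eq hB l l' s s' (Fin.ext_iff.1 h)
  · intro i j
    rw [hβ, hβ]
    cases upperSide i <;> cases upperSide j <;> simp [hlast, hlast.symm]

theorem numComponents_glue_twist_zero [Finite E] (T : Tangle X P E 4) :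
    (T.glue (twist 0)).numComponents =
      Nat.card (Quot (JoinRel T.StrandRel T.boundary rightSide)) := by
  rw [numComponents, Component, strandRel_glue, card_quot_glueRel (γ := Bool) Prod.snd
    (fun s => ⟨(0, s), rfl⟩) ?_ ?_ rightSide (twist_boundary_snd_eq_iff _)]
  · rw [Nat.add_eq_left]
    have : IsEmpty {c : Bool // ∀ i, ((twist 0).boundary i).2 ≠ c} := by
      refine ⟨fun ⟨c, hc⟩ => ?_⟩
      cases c
      · exact hc 2 rfl
      · exact hc 0 rfl
    exact Nat.card_of_isEmpty
  · rintro _ _ (⟨x⟩ | ⟨x⟩ | ⟨⟨⟩⟩)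
    · exact x.elim0
    · exact x.elim0
  · rintro ⟨l, s⟩ ⟨l', s'⟩ rfl
    rw [Subsingleton.elim (α := Fin 1) l l']

theorem numComponents_glue_smoothing [Finite E] (T : Tangle X P E 4) :
    (T.glue smoothing).numComponents =
      Nat.card (Quot (JoinRel T.StrandRel T.boundary upperSide)) := by
  rw [numComponents, Component, strandRel_glue, card_quot_glueRel (γ := Fin 2) id
    Function.surjective_id ?_ ?_ upperSide ?_]
  · rw [Nat.add_eq_left]
    have : IsEmpty {c : Fin 2 // ∀ i, id (smoothing.boundary i) ≠ c} := by
      refine ⟨fun ⟨c, hc⟩ => ?_⟩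
      fin_cases c
      · exact hc 0 rfl
      · exact hc 1 rfl
    exact Nat.card_of_isEmpty
  · rintro _ _ (⟨⟨⟩⟩ | ⟨⟨⟩⟩ | ⟨⟨⟩⟩)
  · rintro _ _ rfl
    rfl
  · intro i j
    fin_cases i <;> fin_cases j <;> simp [boundary, smoothing, upperSide]

/-- The strand of a twist through an edge: the side on which it starts at the bottom. -/
def twistStrand {k : ℕ} (e : Fin (k + 1) × Bool) : Bool := xor e.2 (decide (Odd e.1.val))

theorem twistStrand_eq_of_strandRel {k : ℕ} (e e' : Fin (k + 1) × Bool)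
    (h : (twist k).StrandRel e e') : twistStrand e = twistStrand e' := by
  rcases h with ⟨x⟩ | ⟨x⟩ | ⟨⟨⟩⟩ <;>
    simp [twistStrand, twist, twistLabel, Nat.odd_add_one, -Nat.not_odd_iff_even] <;> rfl

theorem component_twist {k : ℕ} (l : Fin (k + 1)) (s : Bool) :
    (twist k).component (l, s) = (twist k).component (0, twistStrand (l, s)) := by
  induction l using Fin.induction generalizing s with
  | zero => simp [twistStrand]
  | succ x ih =>
    have : (twist k).component (x.succ, s) = (twist k).component (x.castSucc, !s) := by
      cases s
      · exact (Quot.sound (.underStrand (D := twist k) x)).symm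
      · exact Quot.sound (.overStrand (D := twist k) x)
    rw [this, ih]
    simp [twistStrand, Nat.odd_add_one, -Nat.not_odd_iff_even]

/-- Each crossing swaps the sides, so an odd twist joins diagonally opposite boundary points. -/
theorem numComponents_glue_twist_odd [Finite E] (T : Tangle X P E 4) {k : ℕ} (hk : Odd k) :
    (T.glue (twist k)).numComponents =
      Nat.card (Quot (JoinRel T.StrandRel T.boundary diagonal)) := by
  have hβ (i) : twistStrand ((twist k).boundary i) = diagonal i := by
    fin_cases i <;> simp [boundary, twist, twistLabel, twistStrand, diagonal, hk]
  rw [numComponents, Component, strandRel_glue, card_quot_glueRel (γ := Bool) twistStrand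
    (fun s => ⟨(0, s), by simp [twistStrand]⟩) twistStrand_eq_of_strandRel ?_ diagonal
    (by simp [hβ])]
  · rw [Nat.add_eq_left]
    have : IsEmpty {c : Bool // ∀ i, twistStrand ((twist k).boundary i) ≠ c} := by
      refine ⟨fun ⟨c, hc⟩ => ?_⟩
      simp only [hβ] at hc
      cases c
      · exact hc 1 rfl
      · exact hc 0 rfl
    exact Nat.card_of_isEmpty
  · rintro ⟨l, s⟩ ⟨l', s'⟩ h
    have := (component_twist l s).trans (h ▸ (component_twist l' s').symm)
    exact this


/-! ### The state sum -/

/-- Kauffman's state sum at the value `r` of `√t`, normalized such that the state in which all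
smoothings are `A`-smoothings has weight `1`. -/
noncomputable def stateSum [Fintype X] (D : Diagram X P E) (r : ℂˣ) : ℂ :=
  ∑ S : Finset X, (r : ℂ) ^ S.card * (-r - (r : ℂ)⁻¹) ^ (D.loops S - 1)

theorem Orientation.sign_eq_one_or {n : ℕ} {D : Tangle X P E n} (o : D.Orientation) (x : X) :
    o.sign x = 1 ∨ o.sign x = -1 := by
  unfold Orientation.sign
  split_ifs <;> simp

/-- For `p` positive and `m` negative crossings, `2 (p - 2 m) = 3 (p - m) - (p + m)`. Only the
writhe and the number of crossings enter the normalization. -/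
theorem jonesAt_eq [Fintype X] (D : Diagram X P E) (o : D.Orientation) (r : ℂˣ) {a : ℤ}
    (ha : 2 * a = 3 * ∑ x, o.sign x - Fintype.card X) :
    D.jonesAt o r = (-1) ^ Fintype.card X * (r : ℂ) ^ a * D.stateSum r := by
  have h1 : (Finset.univ.filter fun x => o.sign x = 1).card +
      (Finset.univ.filter fun x => o.sign x = -1).card = Fintype.card X := by
    rw [Finset.card_filter, Finset.card_filter, ← Finset.sum_add_distrib, Fintype.card_eq_sum_ones]
    refine Finset.sum_congr rfl fun x _ => ?_
    rcases o.sign_eq_one_or x with h | h <;> simp [h]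
  have h2 : ((Finset.univ.filter fun x => o.sign x = 1).card : ℤ) -
      (Finset.univ.filter fun x => o.sign x = -1).card = ∑ x, o.sign x := by
    rw [Finset.card_filter, Finset.card_filter]
    push_cast
    rw [← Finset.sum_sub_distrib]
    refine Finset.sum_congr rfl fun x _ => ?_
    rcases o.sign_eq_one_or x with h | h <;> simp [h]
  unfold jonesAt jones
  simp only
  rw [h1, show (((Finset.univ.filter fun x => o.sign x = 1).card : ℤ) -
    2 * (Finset.univ.filter fun x => o.sign x = -1).card) = a by omega]
  simp only [map_mul, map_pow, map_neg, map_one, map_sum, map_sub, LaurentPolynomial.eval₂_T,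
    stateSum, Units.val_zpow_eq_zpow_val, zpow_natCast, zpow_one, zpow_neg,
    Units.val_pow_eq_pow_val, Units.val_inv_eq_inv_val]

theorem stateSum_glue [Fintype X] [Fintype X'] (T : Tangle X P E 4)
    (I : Tangle X' P' E' 4) (r : ℂˣ) :
    (T.glue I).stateSum r = ∑ A : Finset X, ∑ B : Finset X', (r : ℂ) ^ (A.card + B.card) *
      (-r - (r : ℂ)⁻¹) ^ ((T.glue I).loops (A.disjSum B) - 1) := by
  rw [stateSum, ← Finset.sumEquiv.symm.toEquiv.sum_comp, Fintype.sum_prod_type]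
  refine Finset.sum_congr rfl fun A _ => Finset.sum_congr rfl fun B _ => ?_
  change (r : ℂ) ^ (A.disjSum B).card * (-r - (r : ℂ)⁻¹) ^ ((T.glue I).loops (A.disjSum B) - 1) = _
  rw [Finset.card_disjSum]

/-- If `(-t) ^ k = 1` and `t ≠ -1`, then replacing two vertical arcs by a vertical twist with `k`
crossings does not change the state sum. -/
theorem stateSum_glue_twist [Fintype X] [Finite E] (T : Tangle X P E 4) (k : ℕ) (r : ℂˣ)
    (hr : ((r : ℂ) ^ 2) ^ k = (-1) ^ k) (hr' : (r : ℂ) ^ 2 ≠ -1) :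
    (T.glue (twist k)).stateSum r = (T.glue (twist 0)).stateSum r := by
  classical
  have h0 : (r : ℂ) ≠ 0 := r.ne_zero
  rw [stateSum_glue, stateSum_glue]
  refine Finset.sum_congr rfl fun A _ => ?_
  rw [← Finset.add_sum_erase _ _ (Finset.mem_univ (∅ : Finset (Fin k))),
    ← Finset.add_sum_erase _ _ (Finset.mem_univ (∅ : Finset (Fin 0))),
    loops_glue_twist_empty, loops_glue_twist_empty]
  congr 1
  rw [show (Finset.univ.erase (∅ : Finset (Fin 0))) = ∅ by
    ext s; simp [Subsingleton.elim s ∅], Finset.sum_empty]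
  set δ : ℂ := -r - (r : ℂ)⁻¹ with hδ
  -- `-δ r = t + 1`, so `δ` vanishes only at the excluded value `t = -1`.
  have hδ0 : δ ≠ 0 := by
    intro h
    apply hr'
    have : δ * r = -(r : ℂ) ^ 2 - 1 := by rw [hδ, sub_mul, inv_mul_cancel₀ h0]; ring
    rw [h, zero_mul] at this
    linear_combination this
  have hrδ : (r : ℂ) * δ + 1 = -(r : ℂ) ^ 2 := by rw [hδ, mul_sub, mul_inv_cancel₀ h0]; ring
  have : Nonempty (Quot (JoinRel (T.StateRel A) T.boundary upperSide)) :=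
    ⟨Quot.mk _ (T.boundary 0)⟩
  have : Finite (Quot (JoinRel (T.StateRel A) T.boundary upperSide)) := Quot.finite _
  have hpos : 0 < Nat.card (Quot (JoinRel (T.StateRel A) T.boundary upperSide)) :=
    Nat.card_pos
  obtain ⟨N, hN⟩ := Nat.exists_eq_succ_of_ne_zero hpos.ne'
  -- The number of loops is `N + 1 + (B.card - 1)`, so the exponent of `δ` is `N + B.card - 1`; the
  -- factor `δ⁻¹` makes the dependence on `B` a pure power.
  have hterm : ∀ B ∈ Finset.univ.erase (∅ : Finset (Fin k)),
      (r : ℂ) ^ (A.card + B.card) * δ ^ ((T.glue (twist k)).loops (A.disjSum B) - 1) =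
        (r : ℂ) ^ A.card * δ ^ N * δ⁻¹ * (r * δ) ^ B.card := by
    intro B hB
    have hB' : B.Nonempty := Finset.nonempty_iff_ne_empty.2 (Finset.ne_of_mem_erase hB)
    have hc := hB'.card_pos
    obtain ⟨b, hb⟩ := Nat.exists_eq_succ_of_ne_zero hc.ne'
    rw [loops_glue_twist_nonempty T A hB', hN, hb, show N.succ + (b.succ - 1) - 1 = N + b by omega]
    rw [Nat.succ_eq_add_one, mul_pow, pow_succ δ b, pow_add, pow_add]
    field_simp
    exact pow_add δ N b
  -- By the binomial theorem the sum over nonempty `B` is `(r δ + 1) ^ k - 1 = (-t) ^ k - 1 = 0`.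
  rw [Finset.sum_congr rfl hterm, ← Finset.mul_sum, Finset.sum_erase_eq_sub (Finset.mem_univ _)]
  have := Fintype.sum_pow_mul_eq_add_pow (Fin k) ((r : ℂ) * δ) 1
  simp only [one_pow, mul_one, Fintype.card_fin] at this
  rw [this, hrδ, neg_pow, hr, ← mul_pow]
  simp


/-! ### Orientations of glued diagrams -/

/-- Two orientations that agree at a dart agree along the whole component. -/
theorem Orientation.agree {D : Tangle X P E n} (o o' : D.Orientation) {d d' : Dart X P n}
    (h : D.component (D.label d) = D.component (D.label d')) (hd : o'.out d = o.out d) :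
    o'.out d' = o.out d' := by
  have hedge (d d' : Dart X P n) (hl : D.label d = D.label d') (hd : o'.out d = o.out d) :
      o'.out d' = o.out d' := by
    by_cases hne : d = d'
    · rwa [← hne]
    · rw [o.edge d d' hne hl, o'.edge d d' hne hl, hd]
  let f : E → Prop := fun e => ∀ d, D.label d = e → o'.out d = o.out d
  have hf (d) : f (D.label d) ↔ o'.out d = o.out d :=
    ⟨fun h => h d rfl, fun h d' hd' => hedge d d' hd'.symm h⟩
  have : f (D.label d) = f (D.label d') := by
    refine strand_apply_eq (fun e e' hs => propext ?_) h
    rcases hs with x | x | p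
    · rw [hf, hf, o.underStrand, o'.underStrand, Bool.not_inj_iff]
    · rw [hf, hf, o.overStrand, o'.overStrand, Bool.not_inj_iff]
    · rw [hf, hf, o.point, o'.point, Bool.not_inj_iff]
  exact (hf d').1 (this ▸ (hf d).2 hd)

/-- The orientation of the tangle outside the disk. -/
def Orientation.outside {T : Tangle X P E 4} {I : Tangle X' P' E' 4}
    (o : (T.glue I).Orientation) : T.Orientation where
  out d := o.out (outer X' P' d)
  edge d d' hne h := o.edge _ _ (outer_injective.ne hne)
    ((glueLabel_outer T I d).trans ((congrArg Sum.inl h).trans (glueLabel_outer T I d').symm))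
  underStrand x := o.underStrand (.inl x)
  overStrand x := o.overStrand (.inl x)
  point p := o.point (.inl p)

/-- The orientation of the tangle inside the disk. -/
def Orientation.inside {T : Tangle X P E 4} {I : Tangle X' P' E' 4}
    (o : (T.glue I).Orientation) : I.Orientation where
  out d := o.out (inner X P d)
  edge d d' hne h := o.edge _ _ (inner_injective.ne hne)
    ((glueLabel_inner T I d).trans ((congrArg Sum.inr h).trans (glueLabel_inner T I d').symm))
  underStrand x := o.underStrand (.inr x)
  overStrand x := o.overStrand (.inr x)
  point p := o.point (.inr (.inl p))

theorem Orientation.inside_bd {T : Tangle X P E 4} {I : Tangle X' P' E' 4}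
    (o : (T.glue I).Orientation) (i : Fin 4) :
    o.inside.out (.bd i) = !o.outside.out (.bd i) :=
  o.point (.inr (.inr i))

/-- Orientations inside and outside the disk that match at the boundary points. -/
def Orientation.glue {T : Tangle X P E 4} {I : Tangle X' P' E' 4} (o : T.Orientation)
    (o' : I.Orientation) (h : ∀ i, o'.out (.bd i) = !o.out (.bd i)) :
    (T.glue I).Orientation where
  out
    | .cr (.inl x) s => o.out (.cr x s)
    | .cr (.inr x) s => o'.out (.cr x s)
    | .pt (.inl p) s => o.out (.pt p s)
    | .pt (.inr (.inl p)) s => o'.out (.pt p s)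
    | .pt (.inr (.inr i)) 0 => o.out (.bd i)
    | .pt (.inr (.inr i)) 1 => o'.out (.bd i)
  edge c c' hne hl := by
    change glueLabel T I c = glueLabel T I c' at hl
    obtain ⟨d, rfl⟩ | ⟨d, rfl⟩ := outer_or_inner c <;>
      obtain ⟨d', rfl⟩ | ⟨d', rfl⟩ := outer_or_inner c'
    · rw [glueLabel_outer, glueLabel_outer, Sum.inl.injEq] at hl
      have := o.edge d d' (fun h => hne (h ▸ rfl)) hl
      rcases d with _ | _ | _ <;> rcases d' with _ | _ | _ <;> exact this
    · simp [glueLabel_outer, glueLabel_inner] at hl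
    · simp [glueLabel_outer, glueLabel_inner] at hl
    · rw [glueLabel_inner, glueLabel_inner, Sum.inr.injEq] at hl
      have := o'.edge d d' (fun h => hne (h ▸ rfl)) hl
      rcases d with _ | _ | _ <;> rcases d' with _ | _ | _ <;> exact this
  underStrand := by
    rintro (x | x)
    exacts [o.underStrand x, o'.underStrand x]
  overStrand := by
    rintro (x | x)
    exacts [o.overStrand x, o'.overStrand x]
  point := by
    rintro (p | p | i)
    exacts [o.point p, o'.point p, h i]

theorem Orientation.outside_glue {T : Tangle X P E 4} {I : Tangle X' P' E' 4} (o : T.Orientation)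
    (o' : I.Orientation) (h : ∀ i, o'.out (.bd i) = !o.out (.bd i)) :
    (o.glue o' h).outside = o := by
  ext d
  rcases d with _ | _ | _ <;> rfl

theorem Orientation.ext_outside_inside {T : Tangle X P E 4} {I : Tangle X' P' E' 4}
    {o o' : (T.glue I).Orientation} (h : o.outside = o'.outside) (h' : o.inside = o'.inside) :
    o = o' := by
  ext c
  obtain ⟨d, rfl⟩ | ⟨d, rfl⟩ := outer_or_inner c
  · exact congrFun (congrArg Orientation.out h) d
  · exact congrFun (congrArg Orientation.out h') d

/-- All components of the tangle reach the boundary. -/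
def NoClosed (I : Tangle X P E n) : Prop :=
  ∀ d, ∃ i, I.component (I.label (.bd i)) = I.component (I.label d)

theorem Orientation.ext_of_noClosed {I : Tangle X P E n} (hI : I.NoClosed)
    {o o' : I.Orientation} (h : ∀ i, o.out (.bd i) = o'.out (.bd i)) : o = o' := by
  ext d
  obtain ⟨i, hi⟩ := hI d
  exact agree o' o hi (h i)

open Classical in
/-- Reversing the strands in `K`. -/
noncomputable def Orientation.reverse {D : Tangle X P E n} (o : D.Orientation) (K : E → Prop)
    (hK : ∀ e e', D.StrandRel e e' → (K e ↔ K e')) : D.Orientation where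
  out d := xor (o.out d) (decide (K (D.label d)))
  edge d d' hne h := by rw [o.edge d d' hne h, h, Bool.not_xor]
  underStrand x := by rw [o.underStrand, Bool.not_xor, decide_eq_decide.2 (hK _ _ (.underStrand x))]
  overStrand x := by rw [o.overStrand, Bool.not_xor, decide_eq_decide.2 (hK _ _ (.overStrand x))]
  point p := by rw [o.point, Bool.not_xor, decide_eq_decide.2 (hK _ _ (.point p))]

theorem component_glue_eq_of_strandRel (T : Tangle X P E 4) (I : Tangle X' P' E' 4) {e e' : E}
    (h : T.StrandRel e e') :
    (T.glue I).component (.inl e) = (T.glue I).component (.inl e') :=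
  Quot.sound (by rw [strandRel_glue]; exact .outer h)

theorem component_glue_inl_boundary (T : Tangle X P E 4) (I : Tangle X' P' E' 4) (i : Fin 4) :
    (T.glue I).component (.inl (T.label (.bd i))) =
      (T.glue I).component (.inr (I.label (.bd i))) :=
  (T.glue I).component_point (.inr (.inr i))

-- Outside the disk the orientation is forced: it is `o` reversed along `K`. Hypothesis `h` extends
-- it inside, and the extension is unique because every strand of `J` reaches the boundary.
open Classical in
theorem existsUnique_reverses {T : Tangle X P E 4} {I : Tangle X' P' E' 4}
    {J : Tangle X'' P'' E'' 4} (hJ : J.NoClosed) (o : (T.glue I).Orientation)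
    (K : Set (T.glue I).Component)
    (h : ∃ j : J.Orientation, ∀ i, j.out (.bd i) = !xor (o.outside.out (.bd i))
      (decide ((T.glue I).component (.inr (I.label (.bd i))) ∈ K))) :
    ∃! o' : (T.glue J).Orientation, Reverses o K o' := by
  obtain ⟨j, hj⟩ := h
  let oK := o.outside.reverse (fun e => (T.glue I).component (.inl e) ∈ K)
    fun e e' h => by rw [component_glue_eq_of_strandRel T I h]
  have hj' (i) : j.out (.bd i) = !oK.out (.bd i) := by
    rw [hj, ← component_glue_inl_boundary]; rfl
  have hiff (o' : (T.glue J).Orientation) : Reverses o K o' ↔ o'.outside = oK := by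
    have (d : Dart X P 4) : (o'.out (outer X'' P'' d) = o.out (outer X' P' d) ↔
        (T.glue I).component (.inl (T.label d)) ∉ K) ↔ o'.outside.out d = oK.out d := by
      change _ ↔ o'.out (outer X'' P'' d) = xor (o.out (outer X' P' d)) _
      by_cases hd : (T.glue I).component (.inl (T.label d)) ∈ K <;>
      cases o'.out (outer X'' P'' d) <;> cases o.out (outer X' P' d) <;> simp [hd]
    exact ⟨fun h => by ext d; exact (this d).1 (h d),
      fun h d => (this d).2 (congrFun (congrArg Orientation.out h) d)⟩
  refine ⟨oK.glue j hj', (hiff _).2 (Orientation.outside_glue _ _ _), fun o' ho' => ?_⟩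
  replace ho' := (hiff o').1 ho'
  refine Orientation.ext_outside_inside (ho'.trans (Orientation.outside_glue _ _ _).symm)
    (Orientation.ext_of_noClosed hJ fun i => ?_)
  rw [Orientation.inside_bd, Orientation.inside_bd, ho', Orientation.outside_glue]

/-! ### Orientations of the smoothing and of twists -/

theorem noClosed_smoothing : smoothing.NoClosed := by
  rintro (⟨⟨⟩⟩ | ⟨⟨⟩⟩ | i)
  exact ⟨i, rfl⟩

theorem exists_orientation_smoothing (b : Fin 4 → Bool) (h03 : b 3 = !b 0) (h12 : b 2 = !b 1) :
    ∃ o : smoothing.Orientation, ∀ i, o.out (.bd i) = b i := by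
  refine ⟨⟨fun | .bd i => b i, ?_, fun x => x.elim, fun x => x.elim, fun p => p.elim⟩,
    fun _ => rfl⟩
  rintro (⟨⟨⟩⟩ | ⟨⟨⟩⟩ | i) (⟨⟨⟩⟩ | ⟨⟨⟩⟩ | j) hne hl
  fin_cases i <;> fin_cases j <;> simp_all [smoothing]

theorem twistStrand_zero {k : ℕ} (s : Bool) : twistStrand ((0 : Fin (k + 1)), s) = s := by
  simp [twistStrand]

theorem noClosed_twist (k : ℕ) : (twist k).NoClosed := by
  intro d
  rcases hd : (twist k).label d with ⟨l, s⟩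
  rw [component_twist]
  cases twistStrand (l, s)
  exacts [⟨3, rfl⟩, ⟨0, rfl⟩]

/-- The darts of a twist that point upwards. -/
def pointsUp {k : ℕ} : Dart (Fin k) Empty 4 → Bool
  | .cr _ s => ![false, true, true, false] s
  | .bd i => ![true, false, false, true] i

theorem pointsUp_eq_not {k : ℕ} {d d' : Dart (Fin k) Empty 4} (hne : d ≠ d')
    (h : (twist k).label d = (twist k).label d') : pointsUp d' = !pointsUp d := by
  have h1 (x : Fin k) : x.castSucc ≠ Fin.last k := x.castSucc_lt_last.ne
  have h2 (x : Fin k) : Fin.last k ≠ x.castSucc := (h1 x).symm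
  have h3 (x : Fin k) : x.succ ≠ 0 := x.succ_ne_zero
  have h4 (x : Fin k) : 0 ≠ x.succ := (h3 x).symm
  rcases d with ⟨x, s⟩ | ⟨⟨⟩⟩ | i <;> rcases d' with ⟨x', s'⟩ | ⟨⟨⟩⟩ | i'
  · fin_cases s <;> fin_cases s' <;> simp_all [twist, twistLabel, pointsUp]
  · fin_cases s <;> fin_cases i' <;> simp_all [twist, twistLabel, pointsUp]
  · fin_cases i <;> fin_cases s' <;> simp_all [twist, twistLabel, pointsUp]
  · fin_cases i <;> fin_cases i' <;> simp_all [twist, twistLabel, pointsUp]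

/-- The orientation of a twist in which the strand that starts at the bottom on the side `s` is
directed upwards if and only if `a s = true`. -/
def twistOrientation (k : ℕ) (a : Bool → Bool) : (twist k).Orientation where
  out d := !xor (pointsUp d) (a (twistStrand ((twist k).label d)))
  edge d d' hne h := by rw [h, pointsUp_eq_not hne h, Bool.not_xor]
  underStrand x := by
    rw [twistStrand_eq_of_strandRel _ _ (.underStrand x)]
    simp [pointsUp]
  overStrand x := by
    rw [twistStrand_eq_of_strandRel _ _ (.overStrand x)]
    simp [pointsUp]
  point p := p.elim

theorem twistStrand_boundary {k : ℕ} (hk : Odd k) (i : Fin 4) :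
    twistStrand ((twist k).label (.bd i)) = diagonal i := by
  fin_cases i <;> simp [twist, twistLabel, twistStrand, diagonal, hk]

theorem exists_orientation_twist {k : ℕ} (hk : Odd k) (b : Fin 4 → Bool) (h02 : b 2 = !b 0)
    (h13 : b 3 = !b 1) : ∃ o : (twist k).Orientation, ∀ i, o.out (.bd i) = b i := by
  refine ⟨twistOrientation k fun s => if s then b 0 else b 3, fun i => ?_⟩
  simp only [twistOrientation, twistStrand_boundary hk]
  fin_cases i <;> simp [pointsUp, diagonal, h02, h13]

/-- The crossings of a twist are positive if and only if both
strands are directed upwards or both are directed downwards. -/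
theorem sign_twist {k : ℕ} (o : (twist k).Orientation) (x : Fin k) :
    o.sign x = if o.out (.bd 0) = o.out (.bd 3) then 1 else -1 := by
  -- Every strand of the twist starts at the bottom, so the directions there determine the whole
  -- orientation.
  have ho (d) : o.out d = (twistOrientation k fun s =>
      if s then o.out (.bd 0) else o.out (.bd 3)).out d := by
    rcases hd : (twist k).label d with ⟨l, s⟩
    cases hs : twistStrand ((twist k).label d)
    · refine Orientation.agree _ _ (d := .bd 3) ?_ ?_
      · rw [hd] at hs ⊢
        rw [component_twist l s, hs]
        rfl
      · simp [twistOrientation, pointsUp, twist, twistLabel, twistStrand_zero]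
    · refine Orientation.agree _ _ (d := .bd 0) ?_ ?_
      · rw [hd] at hs ⊢
        rw [component_twist l s, hs]
        rfl
      · simp [twistOrientation, pointsUp, twist, twistLabel, twistStrand_zero]
  have h1 := ho (.cr x 1)
  have h2 := ho (.cr x 2)
  rw [Orientation.sign, h1, h2]
  have : twistStrand ((twist k).label (.cr x 1)) = !twistStrand ((twist k).label (.cr x 2)) := by
    simp [twistStrand, twist, twistLabel]
    rfl
  simp only [twistOrientation, this, pointsUp]
  cases twistStrand ((twist k).label (.cr x 2)) <;> simp [eq_comm]


/-! ### Signs and linking numbers -/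

open Classical in
/-- Reversing the components in `K` changes the signs of the crossings at which exactly one of the
strands belongs to `K`. -/
theorem Reverses.sign_outside {T : Tangle X P E 4} {I : Tangle X' P' E' 4}
    {J : Tangle X'' P'' E'' 4} {o : (T.glue I).Orientation} {K : Set (T.glue I).Component}
    {o' : (T.glue J).Orientation} (h : Reverses o K o') (x : X) :
    o'.outside.sign x = o.outside.sign x -
      2 * if ¬((T.glue I).component (.inl (T.label (.cr x 0))) ∈ K ↔
        (T.glue I).component (.inl (T.label (.cr x 1))) ∈ K) then o.outside.sign x else 0 := by
  have h0 : o'.outside.out (.cr x 0) = o.outside.out (.cr x 0) ↔ _ := h (.cr x 0)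
  have h1 : o'.outside.out (.cr x 1) = o.outside.out (.cr x 1) ↔ _ := h (.cr x 1)
  simp only [Orientation.sign, Orientation.underStrand]
  revert h0 h1
  by_cases a : (T.glue I).component (.inl (T.label (.cr x 0))) ∈ K <;>
  by_cases b : (T.glue I).component (.inl (T.label (.cr x 1))) ∈ K <;>
  cases o.outside.out (.cr x 0) <;> cases o.outside.out (.cr x 1) <;>
  cases o'.outside.out (.cr x 0) <;> cases o'.outside.out (.cr x 1) <;> simp [a, b]

theorem Reverses.outside_out {T : Tangle X P E 4} {I : Tangle X' P' E' 4}
    {J : Tangle X'' P'' E'' 4} {o : (T.glue I).Orientation} {K : Set (T.glue I).Component}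
    {o' : (T.glue J).Orientation} (h : Reverses o K o') (i : Fin 4) :
    o'.outside.out (.bd i) = o.outside.out (.bd i) ↔
      (T.glue I).component (.inr (I.label (.bd i))) ∉ K := by
  rw [← component_glue_inl_boundary]
  exact h (.bd i)

theorem Reverses.outside_eq {T : Tangle X P E 4} {I : Tangle X' P' E' 4}
    {J : Tangle X'' P'' E'' 4} {o : (T.glue I).Orientation} {o' : (T.glue J).Orientation}
    (h : Reverses o ∅ o') : o'.outside = o.outside := by
  ext d
  exact (h d).2 (Set.notMem_empty _)

-- The division by 2 in `lk` is exact: a sum of signs has the parity of the number of its terms,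
-- which is even by `Planar.even_card_mixed`. There are no crossings inside the disk.
open Classical in
theorem two_mul_lk [Fintype X] [Finite P] [Finite E] [Fintype X'] [IsEmpty X']
    {T : Tangle X P E 4} (hT : T.Planar) {I : Tangle X' P' E' 4} (o : (T.glue I).Orientation)
    (K : Set (T.glue I).Component)
    (hI : (I.label (.bd 0) = I.label (.bd 1) ∧ I.label (.bd 2) = I.label (.bd 3)) ∨
      (I.label (.bd 0) = I.label (.bd 3) ∧ I.label (.bd 1) = I.label (.bd 2))) :
    2 * (T.glue I).lk o K Kᶜ = ∑ x : X,
      if ¬((T.glue I).component (.inl (T.label (.cr x 0))) ∈ K ↔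
        (T.glue I).component (.inl (T.label (.cr x 1))) ∈ K) then o.outside.sign x else 0 := by
  have heven := hT.even_card_mixed (fun e => (T.glue I).component (.inl e) ∈ K)
    (fun e e' h => by rw [component_glue_eq_of_strandRel T I h]) (by
      simp only [component_glue_inl_boundary]
      rcases hI with ⟨h, h'⟩ | ⟨h, h'⟩
      · left; simp only [h, h', and_self]
      · right; simp only [h, h', and_self])
  have hmod : Even (∑ x : X, if ¬((T.glue I).component (.inl (T.label (.cr x 0))) ∈ K ↔
      (T.glue I).component (.inl (T.label (.cr x 1))) ∈ K) then o.outside.sign x else 0) := by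
    rw [← Finset.sum_filter, ← ZMod.intCast_eq_zero_iff_even, Int.cast_sum]
    rw [Finset.sum_congr rfl (g := fun _ => (1 : ZMod 2)) fun x _ => by
      rcases o.outside.sign_eq_one_or x with h | h <;> rw [h] <;> decide]
    rw [Finset.sum_const, nsmul_one, ZMod.natCast_eq_zero_iff_even]
    exact heven
  rw [← Int.mul_ediv_cancel' hmod.two_dvd, lk, Fintype.sum_sum_type,
    Fintype.sum_empty (ι := X'), add_zero]
  congr 2
  refine Finset.sum_congr rfl fun x _ => ?_
  congr 1
  refine propext ?_
  change ((T.glue I).component (.inl (T.label (.cr x 0))) ∈ K ∧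
    (T.glue I).component (.inl (T.label (.cr x 1))) ∈ Kᶜ) ∨
    ((T.glue I).component (.inl (T.label (.cr x 0))) ∈ Kᶜ ∧
    (T.glue I).component (.inl (T.label (.cr x 1))) ∈ K) ↔ _
  simp only [Set.mem_compl_iff]
  tauto

theorem sum_sign_glue [Fintype X] [Fintype X'] {T : Tangle X P E 4} {I : Tangle X' P' E' 4}
    (o : (T.glue I).Orientation) :
    ∑ x, o.sign x = ∑ x, o.outside.sign x + ∑ x, o.inside.sign x :=
  Fintype.sum_sum_type _

/-- The state sums agree, so only the prefactor of `jonesAt_eq` changes: `k` more crossings give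
`(-1) ^ k`, and `2 b` is the change of three times the writhe minus the number of crossings. -/
theorem jonesAt_glue_twist [Fintype X] [Finite E] {T : Tangle X P E 4} {k : ℕ}
    (o : (T.glue (twist 0)).Orientation) (o' : (T.glue (twist k)).Orientation) (r : ℂˣ)
    (hr : ((r : ℂ) ^ 2) ^ k = (-1) ^ k) (hr' : (r : ℂ) ^ 2 ≠ -1) {b : ℤ}
    (hb : 2 * b = 3 * (∑ x, o'.sign x - ∑ x, o.sign x) - k) :
    (T.glue (twist k)).jonesAt o' r =
      (-1) ^ k * (r : ℂ) ^ b * (T.glue (twist 0)).jonesAt o r := by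
  obtain ⟨a, ha⟩ : ∃ a, 2 * a = 3 * ∑ x, o.sign x - Fintype.card (X ⊕ Fin 0) := by
    -- A crossing of sign `s` contributes `(3 s - 1) / 2`, which is `1` or `-2`.
    refine ⟨∑ x, if o.sign x = 1 then 1 else -2, ?_⟩
    rw [Fintype.card_eq_sum_ones, Nat.cast_sum, Finset.mul_sum, Finset.mul_sum,
      ← Finset.sum_sub_distrib]
    refine Finset.sum_congr rfl fun x _ => ?_
    rcases o.sign_eq_one_or x with h | h <;> simp [h]
  have hcard : Fintype.card (X ⊕ Fin k) = Fintype.card (X ⊕ Fin 0) + k := by simp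
  rw [jonesAt_eq _ o r ha, jonesAt_eq _ o' r (a := a + b) (by rw [hcard]; push_cast; linarith),
    stateSum_glue_twist T k r hr hr', hcard, pow_add, zpow_add₀ r.ne_zero]
  ring

/-! ### Values of `√t` -/

section RootOfUnity

open Complex

/-- `(i √t) ^ 2 = -t`, so `i √t` is a root of unity of order dividing `2 k`. -/
theorem exists_eq_neg_I_mul_exp {k : ℕ} (hk : k ≠ 0) {r : ℂ} (hr : (r ^ 2) ^ k = (-1) ^ k) :
    ∃ m : ℤ, r = -I * exp (Real.pi * I * m / k) := by
  have h : (I * r) ^ (2 * k) = 1 := by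
    rw [pow_mul, mul_pow, mul_pow, hr, I_sq, ← mul_pow]
    norm_num
  have hk' : (k : ℂ) ≠ 0 := Nat.cast_ne_zero.2 hk
  have : NeZero (2 * k) := ⟨by omega⟩
  obtain ⟨m, -, hm⟩ := (isPrimitiveRoot_exp (2 * k) (by omega)).eq_pow_of_pow_eq_one h
  refine ⟨m, ?_⟩
  rw [← exp_nat_mul] at hm
  have harg : (Real.pi * I * (m : ℤ) / k : ℂ) = m * (2 * Real.pi * I / ((2 * k : ℕ) : ℂ)) := by
    push_cast
    field_simp
  rw [harg, hm, ← mul_assoc, neg_mul, I_mul_I, neg_neg, one_mul]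

theorem pow_of_eq_neg_I_mul_exp {k : ℕ} (hk : k ≠ 0) {r : ℂ} {m : ℤ}
    (h : r = -I * exp (Real.pi * I * m / k)) : (-1) ^ k * r ^ k = (-1) ^ m * I ^ k := by
  have hk' : (k : ℂ) ≠ 0 := Nat.cast_ne_zero.2 hk
  rw [h, mul_pow, ← exp_nat_mul, mul_div_cancel₀ _ hk', mul_comm (Real.pi * I : ℂ), exp_int_mul,
    exp_pi_mul_I, ← mul_assoc, ← mul_pow]
  ring

theorem zpow_of_eq_neg_I_mul_exp {k : ℕ} {r : ℂ} {m : ℤ}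
    (h : r = -I * exp (Real.pi * I * m / k)) (l : ℤ) :
    (r ^ 2) ^ (-3 * l) = (-1) ^ l * exp (-6 * Real.pi * I * m * l / k) := by
  have h2 : r ^ 2 = -1 * exp (2 * (Real.pi * I * m / k)) := by
    rw [h, mul_pow, neg_sq, I_sq, ← exp_nat_mul]
    norm_num
  rw [h2, mul_zpow, ← exp_int_mul, zpow_mul]
  congr 2
  · norm_num
  · push_cast
    ring

end RootOfUnity

/-! ### Components -/

theorem component_glue_congr {T : Tangle X P E 4} (I : Tangle X' P' E' 4) {e e' : E}
    (h : T.component e = T.component e') :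
    (T.glue I).component (.inl e) = (T.glue I).component (.inl e') :=
  strand_apply_eq (f := fun e => (T.glue I).component (.inl e))
    (fun _ _ => component_glue_eq_of_strandRel T I) h

/-- A function on the components of a glued diagram is a pair of functions on the components inside
and outside the disk that match at the boundary points. -/
theorem apply_eq_of_component_glue_eq {T : Tangle X P E 4} {I : Tangle X' P' E' 4} {α : Sort*}
    (f : T.Component → α) (g : E' → α) (hg : ∀ e e', I.StrandRel e e' → g e = g e')
    (hfg : ∀ i, f (T.component (T.label (.bd i))) = g (I.label (.bd i))) {e e' : E'}
    (h : (T.glue I).component (.inr e) = (T.glue I).component (.inr e')) : g e = g e' := by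
  refine strand_apply_eq (f := Sum.elim (fun e => f (T.component e)) g) (fun a b hab => ?_) h
  rw [strandRel_glue] at hab
  rcases hab with hab | hab | i
  · exact congrArg f (Quot.sound hab)
  · exact hg _ _ hab
  · exact hfg i

theorem strandRel_twist_zero (e e' : Fin 1 × Bool) : ¬(twist 0).StrandRel e e' := by
  rintro (⟨x⟩ | ⟨x⟩ | ⟨⟨⟩⟩)
  · exact x.elim0
  · exact x.elim0

theorem strandRel_smoothing (e e' : Fin 2) : ¬smoothing.StrandRel e e' := by
  rintro (⟨⟨⟩⟩ | ⟨⟨⟩⟩ | ⟨⟨⟩⟩)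

/-- The case in which the two arcs lie on different components. -/
theorem components_of_vertical [Finite E] {T : Tangle X P E 4} {k : ℕ} (hk : Odd k)
    (h01 : T.component (T.label (.bd 0)) = T.component (T.label (.bd 1)))
    (h23 : T.component (T.label (.bd 2)) = T.component (T.label (.bd 3)))
    (h02 : T.component (T.label (.bd 0)) ≠ T.component (T.label (.bd 2))) :
    (T.glue (twist k)).numComponents < (T.glue (twist 0)).numComponents ∧
      (T.glue (twist 0)).component (.inr (0, false)) ≠
        (T.glue (twist 0)).component (.inr (0, true)) := by
  constructor
  · have h0 := numComponents_glue_twist_zero T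
    rw [card_quot_joinRel_of_eq fun i j h => ?_] at h0
    · have h1 := card_quot_joinRel_of_ne (R := T.StrandRel) (β := T.boundary) (v := diagonal) 0 2
        rfl h02 fun i => by
          fin_cases i
          exacts [.inl rfl, .inl h01.symm, .inr rfl, .inr h23.symm]
      rw [numComponents_glue_twist_odd T hk]
      omega
    · fin_cases i <;> fin_cases j <;>
        first
        | exact absurd h (by decide)
        | first | rfl | exact h01 | exact h01.symm | exact h23 | exact h23.symm
  · intro h
    have := apply_eq_of_component_glue_eq
      (fun q => q = T.component (T.label (.bd 0))) (fun e => e.2 = true)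
      (fun e e' h => absurd h (strandRel_twist_zero e e')) (fun i => ?_) h
    · simp at this
    · fin_cases i <;> simp [twist, twistLabel, ← h01, ← h23, h02.symm]

/-- The case in which the two arcs lie on the same component. -/
theorem components_of_horizontal [Finite E] {T : Tangle X P E 4} {k : ℕ} (hk : Odd k)
    (h03 : T.component (T.label (.bd 0)) = T.component (T.label (.bd 3)))
    (h12 : T.component (T.label (.bd 1)) = T.component (T.label (.bd 2)))
    (h01 : T.component (T.label (.bd 0)) ≠ T.component (T.label (.bd 1))) :
    (T.glue (twist k)).numComponents = (T.glue (twist 0)).numComponents ∧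
      (T.glue (twist 0)).component (.inr (0, false)) =
        (T.glue (twist 0)).component (.inr (0, true)) ∧
      (T.glue (twist 0)).numComponents < (T.glue smoothing).numComponents ∧
      (T.glue smoothing).component (.inr 0) ≠ (T.glue smoothing).component (.inr 1) := by
  have hmem (i : Fin 4) : Quot.mk T.StrandRel (T.boundary i) = Quot.mk _ (T.boundary 0) ∨
      Quot.mk T.StrandRel (T.boundary i) = Quot.mk _ (T.boundary 1) := by
    fin_cases i
    exacts [.inl rfl, .inr rfl, .inr h12.symm, .inl h03.symm]
  -- Here vertical and diagonal joins both merge the two outer classes, so `L` and the twisted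
  -- diagram have equally many components; the arcs of `smoothing` merge nothing.
  have h0 := card_quot_joinRel_of_ne (R := T.StrandRel) (β := T.boundary) (v := rightSide) 0 1
    rfl h01 hmem
  rw [← numComponents_glue_twist_zero] at h0
  have h1 := card_quot_joinRel_of_ne (R := T.StrandRel) (β := T.boundary) (v := diagonal) 0 2
    rfl (fun h => h01 (h.trans h12.symm))
    fun i => (hmem i).imp_right fun h => h.trans h12
  rw [← numComponents_glue_twist_odd T hk] at h1
  have h2 := numComponents_glue_smoothing T
  rw [card_quot_joinRel_of_eq fun i j h => ?_] at h2
  · refine ⟨by omega, ?_, by omega, fun h => ?_⟩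
    · exact ((component_glue_inl_boundary T (twist 0) 3).symm.trans
        (component_glue_congr (twist 0) h03.symm)).trans
        (component_glue_inl_boundary T (twist 0) 0)
    · have := apply_eq_of_component_glue_eq
        (fun q => q = T.component (T.label (.bd 0))) (fun e => e = 0)
        (fun e e' h => absurd h (strandRel_smoothing e e')) (fun i => ?_) h
      · simp at this
      · fin_cases i <;> simp [smoothing, ← h03, ← h12, h01.symm]
  · fin_cases i <;> fin_cases j <;>
      first
      | exact absurd h (by decide)
      | first | rfl | exact h03 | exact h03.symm | exact h12 | exact h12.symm


/-! ### Existence and writhe of the reversed orientation in the two cases -/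

/-- Each vertical arc enters at one end and leaves at the other. As the two arcs are antiparallel,
the directions alternate around the disk. -/
theorem outside_out_of_twist_zero {T : Tangle X P E 4} (o : (T.glue (twist 0)).Orientation)
    (ho : o.out (outer (Fin 0) Empty (.bd 1)) ≠ o.out (outer (Fin 0) Empty (.bd 2))) :
    o.outside.out (.bd 1) = !o.outside.out (.bd 0) ∧
      o.outside.out (.bd 2) = o.outside.out (.bd 0) ∧
      o.outside.out (.bd 3) = !o.outside.out (.bd 0) := by
  have h1 : o.inside.out (.bd 1) = !o.inside.out (.bd 0) :=
    o.inside.edge _ _ (by simp) rfl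
  have h3 : o.inside.out (.bd 3) = !o.inside.out (.bd 2) :=
    o.inside.edge _ _ (by simp) rfl
  simp only [Orientation.inside_bd] at h1 h3
  change o.outside.out (.bd 1) ≠ o.outside.out (.bd 2) at ho
  revert h1 h3 ho
  cases o.outside.out (.bd 0) <;> cases o.outside.out (.bd 1) <;>
  cases o.outside.out (.bd 2) <;> cases o.outside.out (.bd 3) <;> simp

/-- Reversing one of two vertical arcs that lie on different components. -/
theorem twist_of_vertical [Fintype X] [Finite P] [Finite E] {T : Tangle X P E 4} (hT : T.Planar)
    {k : ℕ} (hk : Odd k) (o : (T.glue (twist 0)).Orientation)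
    (ho : o.out (outer (Fin 0) Empty (.bd 1)) ≠ o.out (outer (Fin 0) Empty (.bd 2)))
    (hne : (T.glue (twist 0)).component (.inr (0, false)) ≠
      (T.glue (twist 0)).component (.inr (0, true)))
    (side : Bool) (c : (T.glue (twist 0)).Component)
    (hc : c = (T.glue (twist 0)).component (.inr (0, side))) :
    (∃! o' : (T.glue (twist k)).Orientation, Reverses o {c} o') ∧
      ∀ o' : (T.glue (twist k)).Orientation, Reverses o {c} o' →
        ∑ x, o'.sign x = ∑ x, o.sign x - 4 * (T.glue (twist 0)).lk o {c} {c}ᶜ + k := by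
  obtain ⟨h1, h2, h3⟩ := outside_out_of_twist_zero o ho
  have hmem (i) : (T.glue (twist 0)).component (.inr ((twist 0).label (.bd i))) ∈ ({c} : Set _) ↔
      rightSide i = side := by
    have hl : (twist 0).label (.bd i) = (0, rightSide i) := by fin_cases i <;> rfl
    rw [Set.mem_singleton_iff, hc, hl]
    cases rightSide i <;> cases side <;> simp [hne, hne.symm]
  refine ⟨existsUnique_reverses (noClosed_twist k) o {c}
    (exists_orientation_twist hk _ ?_ ?_), fun o' ho' => ?_⟩
  · simp only [h2, hmem]
    cases side <;> simp [rightSide]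
  · simp only [h1, h3, hmem]
    cases side <;> simp [rightSide]
  · have hlk := two_mul_lk hT o {c} (.inl ⟨rfl, rfl⟩)
    -- Reversing exactly one of the antiparallel arcs makes the bottom ends parallel, so all twist
    -- crossings are positive.
    have hup : o'.inside.out (.bd 0) = o'.inside.out (.bd 3) := by
      have h0' := ho'.outside_out 0
      have h3' := ho'.outside_out 3
      rw [hmem] at h0' h3'
      rw [Orientation.inside_bd, Orientation.inside_bd, Bool.not_inj_iff]
      rw [h3] at h3'
      revert h0' h3'
      cases side <;> cases o'.outside.out (.bd 0) <;> cases o'.outside.out (.bd 3) <;>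
        cases o.outside.out (.bd 0) <;> simp [rightSide]
    rw [sum_sign_glue, sum_sign_glue, Finset.sum_congr rfl fun x _ => ho'.sign_outside x,
      Finset.sum_sub_distrib, ← Finset.mul_sum, ← hlk,
      Finset.sum_congr rfl fun x _ => sign_twist o'.inside x, if_pos hup]
    simp
    ring

/-- Reversing one of the two components of `L_∞` through the disk. -/
theorem twist_of_horizontal [Fintype X] [Finite P] [Finite E] {T : Tangle X P E 4}
    (hT : T.Planar) {k : ℕ} (hk : Odd k) (o : (T.glue (twist 0)).Orientation)
    (ho : o.out (outer (Fin 0) Empty (.bd 1)) ≠ o.out (outer (Fin 0) Empty (.bd 2)))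
    (hne : (T.glue smoothing).component (.inr 0) ≠ (T.glue smoothing).component (.inr 1))
    (o₁ : (T.glue smoothing).Orientation) (ho₁ : Reverses o ∅ o₁)
    (arc : Fin 2) (c : (T.glue smoothing).Component)
    (hc : c = (T.glue smoothing).component (.inr arc)) :
    (∃! o' : (T.glue (twist k)).Orientation, Reverses o₁ {c} o') ∧
      ∀ o' : (T.glue (twist k)).Orientation, Reverses o₁ {c} o' →
        ∑ x, o'.sign x = ∑ x, o.sign x - 4 * (T.glue smoothing).lk o₁ {c} {c}ᶜ - k := by
  obtain ⟨h1, h2, h3⟩ := outside_out_of_twist_zero o ho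
  rw [← ho₁.outside_eq] at h1 h2 h3
  obtain ⟨upper, rfl⟩ : ∃ upper : Bool, arc = if upper then 1 else 0 := by
    fin_cases arc
    exacts [⟨false, rfl⟩, ⟨true, rfl⟩]
  have hmem (i) : (T.glue smoothing).component (.inr (smoothing.label (.bd i))) ∈ ({c} : Set _) ↔
      upperSide i = upper := by
    have hl : smoothing.label (.bd i) = if upperSide i then 1 else 0 := by fin_cases i <;> rfl
    rw [Set.mem_singleton_iff, hc, hl]
    cases upperSide i <;> cases upper <;> simp [hne, hne.symm]
  refine ⟨existsUnique_reverses (noClosed_twist k) o₁ {c}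
    (exists_orientation_twist hk _ ?_ ?_), fun o' ho' => ?_⟩
  · simp only [h2, hmem]
    cases upper <;> simp [upperSide]
  · simp only [h1, h3, hmem]
    cases upper <;> simp [upperSide]
  · have hlk := two_mul_lk hT o₁ {c} (.inr ⟨rfl, rfl⟩)
    -- The two bottom ends lie on one arc of `L_∞`, so both are reversed or neither is. They stay
    -- antiparallel, and all twist crossings are negative.
    have hup : o'.inside.out (.bd 0) ≠ o'.inside.out (.bd 3) := by
      have h0' := ho'.outside_out 0
      have h3' := ho'.outside_out 3
      rw [hmem] at h0' h3'
      rw [Orientation.inside_bd, Orientation.inside_bd, Ne, Bool.not_inj_iff]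
      rw [h3] at h3'
      revert h0' h3'
      cases upper <;> cases o'.outside.out (.bd 0) <;>
        cases o'.outside.out (.bd 3) <;> cases o₁.outside.out (.bd 0) <;> simp [upperSide]
    rw [sum_sign_glue, sum_sign_glue, Finset.sum_congr rfl fun x _ => ho'.sign_outside x,
      Finset.sum_sub_distrib, ← Finset.mul_sum, ← hlk,
      Finset.sum_congr rfl fun x _ => sign_twist o'.inside x, if_neg hup, ho₁.outside_eq]
    simp
    ring

theorem existsUnique_orientation_smoothing {T : Tangle X P E 4}
    (o : (T.glue (twist 0)).Orientation)
    (ho : o.out (outer (Fin 0) Empty (.bd 1)) ≠ o.out (outer (Fin 0) Empty (.bd 2))) :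
    ∃! o₁ : (T.glue smoothing).Orientation, Reverses o ∅ o₁ := by
  obtain ⟨h1, h2, h3⟩ := outside_out_of_twist_zero o ho
  refine existsUnique_reverses noClosed_smoothing o ∅ (exists_orientation_smoothing _ ?_ ?_) <;>
    simp [h1, h2, h3]

end Tangle
end LinkTheory

open LinkTheory Tangle in
/-- `L = T.glue (twist 0)` is an oriented planar diagram with a disk that meets it in a left and a
right vertical arc, directed oppositely; `t̄ₖ(L) = T.glue (twist k)`, `L_∞ = T.glue smoothing`, and
`r` is the chosen value of `√t`. -/
theorem theorem1p13 {X P E : Type*} [Fintype X] [Finite P] [Finite E]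
    (T : Tangle X P E 4) (hT : T.Planar) (k : ℕ) (hk : Odd k)
    (o : (T.glue (twist 0)).Orientation)
    (ho : o.out (outer (Fin 0) Empty (.bd 1)) ≠ o.out (outer (Fin 0) Empty (.bd 2)))
    (r : ℂˣ) (hr : ((r : ℂ) ^ 2) ^ k = (-1) ^ k) (hr' : (r : ℂ) ^ 2 ≠ -1) :
    -- the admissible values of `√t`
    (∃ m : ℤ, (r : ℂ) = -Complex.I * Complex.exp (Real.pi * Complex.I * m / k)) ∧
    -- the two cases: two components of `L` are involved, or only one
    ((T.glue (twist k)).numComponents < (T.glue (twist 0)).numComponents ↔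
      (T.glue (twist 0)).component (.inr (0, false)) ≠
        (T.glue (twist 0)).component (.inr (0, true))) ∧
    ((T.glue (twist k)).numComponents = (T.glue (twist 0)).numComponents ↔
      (T.glue (twist 0)).component (.inr (0, false)) =
        (T.glue (twist 0)).component (.inr (0, true))) ∧
    -- (i) `Lᵢ` is the component of the left or of the right arc
    ((T.glue (twist k)).numComponents < (T.glue (twist 0)).numComponents →
      ∀ (side : Bool) (Li : (T.glue (twist 0)).Component),
        Li = (T.glue (twist 0)).component (.inr (0, side)) →
        (∃! o' : (T.glue (twist k)).Orientation, Reverses o {Li} o') ∧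
        ∀ o' : (T.glue (twist k)).Orientation, Reverses o {Li} o' →
          ∀ l : ℤ, l = (T.glue (twist 0)).lk o {Li} {Li}ᶜ →
          ∀ m : ℤ, (r : ℂ) = -Complex.I * Complex.exp (Real.pi * Complex.I * m / k) →
            (T.glue (twist k)).jonesAt o' r =
              (-1) ^ m * Complex.I ^ k * ((r : ℂ) ^ 2) ^ (-3 * l) *
                (T.glue (twist 0)).jonesAt o r ∧
            (T.glue (twist k)).jonesAt o' r =
              (-1) ^ (m + l) * Complex.I ^ k *
                Complex.exp (-6 * Real.pi * Complex.I * m * l / k) *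
                (T.glue (twist 0)).jonesAt o r) ∧
    -- (ii) `Lᵢ` is one of the two new components of `L_∞`, which is oriented like `L`
    ((T.glue (twist k)).numComponents = (T.glue (twist 0)).numComponents →
      (T.glue (twist 0)).numComponents < (T.glue smoothing).numComponents ∧
      (T.glue smoothing).component (.inr 0) ≠ (T.glue smoothing).component (.inr 1) ∧
      (∃! o₁ : (T.glue smoothing).Orientation, Reverses o ∅ o₁) ∧
      ∀ o₁ : (T.glue smoothing).Orientation, Reverses o ∅ o₁ →
      ∀ (arc : Fin 2) (Li : (T.glue smoothing).Component),
        Li = (T.glue smoothing).component (.inr arc) →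
        (∃! o' : (T.glue (twist k)).Orientation, Reverses o₁ {Li} o') ∧
        ∀ o' : (T.glue (twist k)).Orientation, Reverses o₁ {Li} o' →
          ∀ l : ℤ, l = (T.glue smoothing).lk o₁ {Li} {Li}ᶜ →
          ∀ m : ℤ, (r : ℂ) = -Complex.I * Complex.exp (Real.pi * Complex.I * m / k) →
            (T.glue (twist k)).jonesAt o' r =
              ((r : ℂ) ^ 2) ^ (-3 * l) * (T.glue (twist 0)).jonesAt o r ∧
            (T.glue (twist k)).jonesAt o' r =
              (-1) ^ l * Complex.exp (-6 * Real.pi * Complex.I * m * l / k) *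
                (T.glue (twist 0)).jonesAt o r) := by
  have hk0 : k ≠ 0 := hk.pos.ne'
  obtain ⟨h1, h2, h3⟩ := outside_out_of_twist_zero o ho
  refine ⟨exists_eq_neg_I_mul_exp hk0 hr, ?_⟩
  rcases boundary_component_cases o.outside h1 h2 h3 with ⟨h01, h23, h02⟩ | ⟨h03, h12, h01⟩
  · obtain ⟨hlt, hne⟩ := components_of_vertical hk h01 h23 h02
    refine ⟨iff_of_true hlt hne, iff_of_false hlt.ne hne, fun _ side Li hLi => ?_,
      fun h => absurd h hlt.ne⟩
    obtain ⟨hex, hsign⟩ := twist_of_vertical hT hk o ho hne side Li hLi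
    refine ⟨hex, fun o' ho' l hl m hm => ?_⟩
    have key : (T.glue (twist k)).jonesAt o' r =
        (-1) ^ m * Complex.I ^ k * ((r : ℂ) ^ 2) ^ (-3 * l) * (T.glue (twist 0)).jonesAt o r := by
      -- Half of `3 (k - 4 l) - k`.
      rw [jonesAt_glue_twist o o' r hr hr' (b := k + 2 * (-3 * l))
        (by rw [hsign o' ho', ← hl]; ring), zpow_add₀ r.ne_zero, zpow_natCast, ← mul_assoc,
        pow_of_eq_neg_I_mul_exp hk0 hm, zpow_mul]
      rfl
    refine ⟨key, ?_⟩
    rw [key, zpow_of_eq_neg_I_mul_exp hm, zpow_add₀ (by norm_num)]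
    ring
  · obtain ⟨heq, hcomp, hlt, hne⟩ := components_of_horizontal hk h03 h12 h01
    refine ⟨iff_of_false heq.not_lt (not_not.2 hcomp), iff_of_true heq hcomp,
      fun h => absurd heq h.ne, fun _ => ⟨hlt, hne, existsUnique_orientation_smoothing o ho,
      fun o₁ ho₁ arc Li hLi => ?_⟩⟩
    obtain ⟨hex, hsign⟩ := twist_of_horizontal hT hk o ho hne o₁ ho₁ arc Li hLi
    refine ⟨hex, fun o' ho' l hl m hm => ?_⟩
    have key : (T.glue (twist k)).jonesAt o' r =
        ((r : ℂ) ^ 2) ^ (-3 * l) * (T.glue (twist 0)).jonesAt o r := by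
      -- The exponent is half of `3 (-k - 4 l) - k`, namely `-2 k - 6 l`; its part `t ^ (-k)`
      -- cancels the sign `(-1) ^ k` of the `k` new crossings.
      have hpow : (r : ℂ) ^ (2 * -(k : ℤ)) = (-1) ^ k := by
        rw [zpow_mul, zpow_neg, zpow_natCast, zpow_ofNat, hr, ← inv_pow]
        norm_num
      rw [jonesAt_glue_twist o o' r hr hr' (b := 2 * -(k : ℤ) + 2 * (-3 * l))
        (by rw [hsign o' ho', ← hl]; ring), zpow_add₀ r.ne_zero, hpow, ← mul_assoc, ← mul_pow,
        zpow_mul]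
      norm_num
    refine ⟨key, ?_⟩
    rw [key, zpow_of_eq_neg_I_mul_exp hm]
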